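/- For real $\nu$ and $x>0$ let $k_\nu(x)=\frac{2}{\pi}\int_0^{\pi/2}\cos(x\tan u-\nu u)\,du$ be the Bateman function. Fix $0<a<1$ and put $\psi(u)=i(\tan u-au)$, $u_0=i\,\mathrm{arctanh}\sqrt{1-a}$ and $\Psi(a)=\sqrt{1-a}-a\,\mathrm{arctanh}\sqrt{1-a}$. Then $\pm u_0$ are saddle points of $\psi$ (that is, $\psi'(\pm u_0)=0$), $\psi(u_0)=-\Psi(a)$, and $\Psi(a)>0$. There is a function $u(w)$, analytic near $w=0$, with $u(0)=u_0$, $\psi(u(w))-\psi(u_0)=-w^2$ near $w=0$, and $u'(0)>0$. For any such $u$ define $\hat A_{2k}(a)$, $k\ge 0$, by letting $\frac{(1-a)^{-1/4}}{\sqrt a}\hat A_{2k}(a)$ be the coefficient of $w^{2k}$ in the Taylor series of $du/dw$ at $w=0$. These $\hat A_{2k}(a)$ are real, with \[\hat A_0(a)=1,\quad \hat A_2(a)=-\frac{8-12a+9a^2}{24a(1-a)^{3/2}},\quad \hat A_4(a)=\frac{64-192a+288a^2+360a^3-135a^4}{3456a^2(1-a)^3},\] \[\hat A_6(a)=\frac{71168-320256a+554688a^2-518400a^3-340200a^4+170100a^5-42525a^6}{6220800a^3(1-a)^{9/2}},\]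 \[\hat A_8(a)=\frac{-2338816+14032896a-36790272a^2+55710720a^3-32876928a^4+231880320a^5-68584320a^6+30618000a^7-5740875a^8}{4180377600a^4(1-a)^6},\] and, as $x\to+\infty$ with $\nu=ax$, \[k_\nu(x)\sim\frac{(1-a)^{-1/4}}{\sqrt{\pi ax}}\,e^{-x\Psi(a)}\sum_{k=0}^\infty\frac{\Gamma(k+\frac12)}{\Gamma(\frac12)}\,\frac{\hat A_{2k}(a)}{x^k}\] in the sense of Poincaré: for each $N\ge 0$, \[k_{ax}(x)=\frac{(1-a)^{-1/4}}{\sqrt{\pi ax}}\,e^{-x\Psi(a)}\left(\sum_{k=0}^{N-1}\frac{\Gamma(k+\frac12)}{\Gamma(\frac12)}\frac{\hat A_{2k}(a)}{x^k}+O(x^{-N})\right).\] -/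

import Mathlib

open Filter Topology Asymptotics

noncomputable section

/-- The Bateman function `k_ν(x) = (2/π) ∫_0^{π/2} cos (x tan u - ν u) du` (the integrand is
bounded and continuous on `[0, π/2)`). -/
def batemanK (ν x : ℝ) : ℝ :=
  (2 / Real.pi) * ∫ u in (0 : ℝ)..(Real.pi / 2), Real.cos (x * Real.tan u - ν * u)

/-- The phase function `ψ(u) = i (tan u - a u)` of a complex variable `u`. -/
def batemanPhase (a : ℝ) (u : ℂ) : ℂ :=
  Complex.I * (Complex.tan u - (a : ℂ) * u)

/-- The point `u₀ = i arctanh √(1 - a)` of the imaginary axis. -/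
def batemanSaddle (a : ℝ) : ℂ :=
  Complex.I * (Real.artanh (Real.sqrt (1 - a)) : ℂ)

/-- `Ψ(a) = √(1 - a) - a arctanh √(1 - a)`. -/
def batemanPsi (a : ℝ) : ℝ :=
  Real.sqrt (1 - a) - a * Real.artanh (Real.sqrt (1 - a))

/-- `u = u(w)` is the (local, analytic) inversion at the saddle `u₀` of the change of variable
`-w² = ψ(u) - ψ(u₀)`, on the branch for which `du/dw` is positive at `w = 0` (the steepest descent
path through `u₀` is traversed from left to right). -/
structure IsSaddleInversion (a : ℝ) (u : ℂ → ℂ) : Prop where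
  analyticAt : AnalyticAt ℂ u 0
  map_zero : u 0 = batemanSaddle a
  phase_eq : ∀ᶠ w in 𝓝 (0 : ℂ), batemanPhase a (u w) - batemanPhase a (batemanSaddle a) = -w ^ 2
  deriv_pos : ∃ r : ℝ, 0 < r ∧ deriv u 0 = (r : ℂ)

/-- The coefficient of `w ^ n` in the Taylor series at `w = 0` of `du/dw`. -/
def derivTaylorCoeff (u : ℂ → ℂ) (n : ℕ) : ℂ :=
  iteratedDeriv n (deriv u) 0 / (n.factorial : ℂ)

/-- The prefactor `(1 - a)^{-1/4} / √(π a x) · e^{-x Ψ(a)}`. -/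
def batemanPrefactor (a x : ℝ) : ℝ :=
  (1 - a) ^ (-(1 / 4) : ℝ) / Real.sqrt (Real.pi * a * x) * Real.exp (-x * batemanPsi a)

/-- `f ∼ p · ∑_{k ≥ 0} c k · x^{-k}` as `x → +∞`, an asymptotic expansion in the sense of Poincaré:
for every `N`, cutting the series before `k = N` leaves a remainder `O (p(x) x^{-N})`. -/
def HasAsymptoticSeries (f p : ℝ → ℝ) (c : ℕ → ℝ) : Prop :=
  ∀ N : ℕ, (fun x : ℝ => f x - p x * ∑ k ∈ Finset.range N, c k / x ^ k)
    =O[atTop] (fun x : ℝ => p x / x ^ N)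

end

/-!
# The Bateman function for `ν = a x`, `0 < a < 1`, by the saddle point method

The substitution `v = tan u` turns the Bateman function into the absolutely convergent integral
`k_{ax}(x) = (1 / π) re ∫ exp (i x (v - a arctan v)) / (1 + v²) dv` over the real line. Its
integrand is holomorphic for `|im v| < 1` and `O(1 / (1 + (re v)²))` for `0 ≤ im v ≤ s < 1`, so the
path may be moved to the line `im v = s`, `s = √(1 - a)`, through the saddle point `tan u₀ = i s`
(`integral_batemanIntegrand_eq`). On that line the modulus of the exponential is governed by
`im (arctan v)`, which is an explicit logarithm, strictly decreasing in `|re v|`. Hence only a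
neighbourhood of the saddle point matters, up to an exponentially small relative error
(`exists_norm_integral_compl_le`).

Near the saddle point let `W` be the holomorphic function with `u (W v) = arctan v`. The integrand
is the derivative of `exp (-x Ψ(a)) K (W v)`, where `K` is a primitive of `exp (-x w²) u'(w)`. The
contribution of the line segment is therefore a difference of values of `K` at two points close to
`±δ`; replacing these by `±δ` costs an exponentially small relative error, since `re w²` stays
bounded below on the segments in between (`exists_local_norm_sub_le`). What remains is
`∫ exp (-x w²) u'(w) dw` over `[-δ, δ]`, to which Watson's lemma
(`exists_norm_intervalIntegral_exp_mul_sub_le`) applies.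

For the coefficients, differentiating the phase equation and the tangent shows that `V = tan u(w)`
satisfies `V' = (1 + V²) u'` and `V' - a u' = 2 i w`. After normalisation `V = i s (1 + Y (w / κ))`
this becomes the single equation `(Y' + c X) (2 Y + Y²) = 2 X`, `c = 2 (1 - a) / a`, for a formal
power series `Y = X + O(X²)` (`exists_saddleSeries`). It has only one solution, so `Y` equals its
complex conjugate and is real; its coefficients are polynomials in `c` found by comparing
coefficients (`saddleSeries_coeff`).

The function `u` exists because the phase has an exact double zero at the saddle point: the square
root of `ψ(u₀) - ψ(u)` is a local coordinate there, and `u` is its inverse.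
-/

namespace Bateman

open MeasureTheory Finset

/-! ### Watson's lemma for a Gaussian weight -/

lemma integrable_abs_pow_mul_exp {x : ℝ} (hx : 0 < x) (n : ℕ) :
    Integrable fun w : ℝ => |w| ^ n * Real.exp (-x * w ^ 2) := by
  have h := integrable_rpow_mul_exp_neg_mul_sq hx (s := n) (by linarith [n.cast_nonneg (α := ℝ)])
  refine h.norm.congr (Eventually.of_forall fun w => ?_)
  simp

lemma integral_abs_pow_mul_exp {x : ℝ} (hx : 0 < x) (k : ℕ) :
    ∫ w : ℝ, |w| ^ (2 * k) * Real.exp (-x * w ^ 2)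
      = Real.Gamma (k + 1 / 2) / (x ^ k * Real.sqrt x) := by
  have h1 : ∫ w : ℝ, |w| ^ (2 * k) * Real.exp (-x * w ^ 2)
      = ∫ w : ℝ, (fun t : ℝ => t ^ (2 * k) * Real.exp (-x * t ^ 2)) |w| := by simp
  have h2 := integral_rpow_mul_exp_neg_mul_rpow (p := 2) (q := ((2 * k : ℕ) : ℝ)) (b := x) two_pos
    (by linarith [(2 * k).cast_nonneg (α := ℝ)]) hx
  simp only [Real.rpow_natCast, Real.rpow_two] at h2
  rw [h1, integral_comp_abs (f := fun t => t ^ (2 * k) * Real.exp (-x * t ^ 2)), h2,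
    show -((((2 * k : ℕ) : ℝ)) + 1) / 2 = -((k : ℝ) + 1 / 2) by push_cast; ring,
    show ((((2 * k : ℕ) : ℝ)) + 1) / 2 = (k : ℝ) + 1 / 2 by push_cast; ring,
    Real.rpow_neg hx.le, Real.rpow_add hx, Real.rpow_natCast, ← Real.sqrt_eq_rpow]
  ring

lemma integral_pow_odd_mul_exp (x : ℝ) (k : ℕ) :
    ∫ w : ℝ, (w : ℂ) ^ (2 * k + 1) * Real.exp (-x * w ^ 2) = 0 := by
  have h := integral_neg_eq_self
    (fun w : ℝ => (w : ℂ) ^ (2 * k + 1) * Real.exp (-x * w ^ 2)) volume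
  have h2 : (fun w : ℝ => ((-w : ℝ) : ℂ) ^ (2 * k + 1) * Real.exp (-x * (-w) ^ 2))
      = fun w : ℝ => -((w : ℂ) ^ (2 * k + 1) * Real.exp (-x * w ^ 2)) := by
    funext w
    rw [Complex.ofReal_neg, Odd.neg_pow ⟨k, rfl⟩, neg_sq, neg_mul]
  rw [h2, integral_neg] at h
  linear_combination (-1 / 2 : ℂ) * h

lemma integral_pow_even_mul_exp {x : ℝ} (hx : 0 < x) (k : ℕ) :
    ∫ w : ℝ, (w : ℂ) ^ (2 * k) * Real.exp (-x * w ^ 2)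
      = ((Real.Gamma (k + 1 / 2) / (x ^ k * Real.sqrt x) : ℝ) : ℂ) := by
  rw [← integral_abs_pow_mul_exp hx, ← integral_complex_ofReal]
  congr 1; funext w
  rw [Even.pow_abs ⟨k, two_mul k⟩]
  push_cast; rfl

lemma integrable_pow_mul_exp {x : ℝ} (hx : 0 < x) (n : ℕ) :
    Integrable fun w : ℝ => (w : ℂ) ^ n * Real.exp (-x * w ^ 2) := by
  refine (integrable_abs_pow_mul_exp hx n).mono' (by fun_prop) (Eventually.of_forall fun w => ?_)
  rw [norm_mul, norm_pow, Complex.norm_real, Complex.norm_real, Real.norm_eq_abs,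
    Real.norm_of_nonneg (Real.exp_pos _).le]

/-- Watson's lemma for a Gaussian weight on the whole line, with an explicit remainder: odd powers
integrate to zero, and even powers and the remainder are Gamma integrals. -/
lemma norm_integral_exp_mul_sub_le {G : ℝ → ℂ} (hG : AEStronglyMeasurable G) (c : ℕ → ℂ) (N : ℕ)
    {C : ℝ} (hC : ∀ w, ‖G w - ∑ n ∈ range (2 * N), c n * (w : ℂ) ^ n‖ ≤ C * |w| ^ (2 * N))
    {x : ℝ} (hx : 0 < x) :
    ‖(∫ w : ℝ, G w * Real.exp (-x * w ^ 2))
        - ∑ k ∈ range N, c (2 * k) * ((Real.Gamma (k + 1 / 2) / (x ^ k * Real.sqrt x) : ℝ) : ℂ)‖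
      ≤ C * (Real.Gamma (N + 1 / 2) / (x ^ N * Real.sqrt x)) := by
  set R : ℝ → ℂ := fun w => G w - ∑ n ∈ range (2 * N), c n * (w : ℂ) ^ n with hR
  have hterm : ∀ n ∈ range (2 * N),
      Integrable fun w : ℝ => c n * ((w : ℂ) ^ n * Real.exp (-x * w ^ 2)) :=
    fun n _ => (integrable_pow_mul_exp hx n).const_mul _
  have hbound : ∀ w : ℝ, ‖R w * Real.exp (-x * w ^ 2)‖
      ≤ C * (|w| ^ (2 * N) * Real.exp (-x * w ^ 2)) := fun w => by
    rw [norm_mul, Complex.norm_real, Real.norm_of_nonneg (Real.exp_pos _).le, ← mul_assoc]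
    exact mul_le_mul_of_nonneg_right (hC w) (Real.exp_pos _).le
  have hRm : AEStronglyMeasurable (fun w : ℝ => R w * (Real.exp (-x * w ^ 2) : ℂ)) volume := by
    refine (hG.sub ?_).mul ?_
    · exact Continuous.aestronglyMeasurable (by fun_prop)
    · exact Continuous.aestronglyMeasurable (by fun_prop)
  have hdom := (integrable_abs_pow_mul_exp hx (2 * N)).const_mul C
  have hRi := hdom.mono' hRm (Eventually.of_forall hbound)
  have hsplit : (fun w : ℝ => G w * (Real.exp (-x * w ^ 2) : ℂ)) = fun w : ℝ =>
      (∑ n ∈ range (2 * N), c n * ((w : ℂ) ^ n * Real.exp (-x * w ^ 2)))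
        + R w * Real.exp (-x * w ^ 2) := by
    funext w
    simp only [hR, sub_mul, sum_mul, mul_assoc]
    ring
  have hparity : ∀ M : ℕ, ∑ n ∈ range (2 * M), ∫ w : ℝ, c n * ((w : ℂ) ^ n * Real.exp (-x * w ^ 2))
      = ∑ k ∈ range M, c (2 * k) * ((Real.Gamma (k + 1 / 2) / (x ^ k * Real.sqrt x) : ℝ) : ℂ) := by
    intro M
    induction M with
    | zero => simp
    | succ M ih =>
      rw [show 2 * (M + 1) = 2 * M + 1 + 1 by ring, sum_range_succ, sum_range_succ, ih,
        sum_range_succ, integral_const_mul, integral_const_mul, integral_pow_odd_mul_exp,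
        integral_pow_even_mul_exp hx, mul_zero, add_zero]
  rw [hsplit, integral_add (integrable_finsetSum _ hterm) hRi, integral_finsetSum _ hterm,
    hparity, add_sub_cancel_left, ← integral_abs_pow_mul_exp hx, ← integral_const_mul]
  exact norm_integral_le_of_norm_le hdom (Eventually.of_forall hbound)

/-- Watson's lemma on a bounded interval. Outside `[-δ, δ]` the Taylor polynomial itself is
`O(|w| ^ (2 * N))`, so extending `g` by zero keeps the remainder estimate, and no tail of the
Gaussian has to be discussed. -/
lemma exists_norm_intervalIntegral_exp_mul_sub_le {g : ℝ → ℂ} {δ : ℝ} (hδ : 0 < δ)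
    (hg : ContinuousOn g (Set.Ioc (-δ) δ)) (c : ℕ → ℂ) (N : ℕ) {C : ℝ}
    (hC : ∀ w ∈ Set.Ioc (-δ) δ,
      ‖g w - ∑ n ∈ range (2 * N), c n * (w : ℂ) ^ n‖ ≤ C * |w| ^ (2 * N)) :
    ∃ D, ∀ x : ℝ, 0 < x →
      ‖(∫ w in (-δ)..δ, g w * Real.exp (-x * w ^ 2))
        - ∑ k ∈ range N, c (2 * k) * ((Real.Gamma (k + 1 / 2) / (x ^ k * Real.sqrt x) : ℝ) : ℂ)‖
      ≤ D / (x ^ N * Real.sqrt x) := by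
  set C' : ℝ := max C (∑ n ∈ range (2 * N), ‖c n‖ / δ ^ (2 * N - n)) with hC'
  refine ⟨C' * Real.Gamma (N + 1 / 2), fun x hx => ?_⟩
  have hint : ∫ w in (-δ)..δ, g w * Real.exp (-x * w ^ 2)
      = ∫ w : ℝ, (Set.Ioc (-δ) δ).indicator g w * Real.exp (-x * w ^ 2) := by
    rw [intervalIntegral.integral_of_le (by linarith), ← integral_indicator measurableSet_Ioc]
    congr 1; funext w
    by_cases hw : w ∈ Set.Ioc (-δ) δ <;> simp [hw]
  rw [hint, mul_div_assoc]
  refine norm_integral_exp_mul_sub_le ((aestronglyMeasurable_indicator_iff measurableSet_Ioc).2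
    (hg.aestronglyMeasurable measurableSet_Ioc)) c N (fun w => ?_) hx
  by_cases hw : w ∈ Set.Ioc (-δ) δ
  · rw [Set.indicator_of_mem hw]
    exact (hC w hw).trans (mul_le_mul_of_nonneg_right (le_max_left _ _) (by positivity))
  · rw [Set.indicator_of_notMem hw, zero_sub, norm_neg]
    have hδw : δ ≤ |w| := by
      rw [Set.mem_Ioc, not_and_or, not_lt, not_le] at hw
      rcases hw with hw | hw
      · linarith [neg_le_abs w]
      · linarith [le_abs_self w]
    refine le_trans ?_ (mul_le_mul_of_nonneg_right (le_max_right _ _) (by positivity))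
    rw [sum_mul]
    refine (norm_sum_le _ _).trans (sum_le_sum fun n hn => ?_)
    rw [norm_mul, norm_pow, Complex.norm_real, Real.norm_eq_abs, div_mul_eq_mul_div,
      le_div_iff₀ (by positivity), mul_assoc]
    refine mul_le_mul_of_nonneg_left ?_ (norm_nonneg _)
    calc |w| ^ n * δ ^ (2 * N - n) ≤ |w| ^ n * |w| ^ (2 * N - n) := by gcongr
      _ = |w| ^ (2 * N) := by
        rw [← pow_add, Nat.add_sub_cancel' (mem_range.mp hn).le]

end Bateman

namespace Bateman

open MeasureTheory Complex

/-! ### Moving the line of integration -/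

/-- If `f` is holomorphic on the strip `0 ≤ im v ≤ s` and `O(1 / (1 + (re v)²))` there, then its
integrals over the two boundary lines agree. -/
lemma integral_eq_integral_add_mul_I {f : ℂ → ℂ} {s C : ℝ} (hs : 0 ≤ s)
    (hf : DifferentiableOn ℂ f {v | 0 ≤ v.im ∧ v.im ≤ s})
    (hC : ∀ y t : ℝ, 0 ≤ t → t ≤ s → ‖f (y + t * I)‖ ≤ C * (1 + y ^ 2)⁻¹) :
    ∫ y : ℝ, f y = ∫ y : ℝ, f (y + s * I) := by
  have hint : ∀ t : ℝ, 0 ≤ t → t ≤ s → Integrable fun y : ℝ => f (y + t * I) := fun t h0 h1 => by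
    refine (integrable_inv_one_add_sq.const_mul C).mono' ?_
      (Eventually.of_forall fun y => hC y t h0 h1)
    refine Continuous.aestronglyMeasurable ?_
    exact hf.continuousOn.comp_continuous (by fun_prop) fun y => by simp [h0, h1]
  have h0 : Integrable fun y : ℝ => f y := by simpa using hint 0 le_rfl hs
  have hlim := (intervalIntegral_tendsto_integral h0 tendsto_neg_atTop_atBot tendsto_id).sub
    (intervalIntegral_tendsto_integral (hint s hs le_rfl) tendsto_neg_atTop_atBot tendsto_id)
  have hzero : Tendsto (fun R : ℝ => (∫ y in (-R)..R, f y) - ∫ y in (-R)..R, f (y + s * I))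
      atTop (𝓝 0) := by
    have hside : ∀ R : ℝ, ‖∫ t in (0 : ℝ)..s, f (R + t * I)‖ ≤ C * (1 + R ^ 2)⁻¹ * s := fun R => by
      have := intervalIntegral.norm_integral_le_of_norm_le_const (a := 0) (b := s)
        (f := fun t : ℝ => f (R + t * I)) (C := C * (1 + R ^ 2)⁻¹) fun t ht => by
          rw [Set.uIoc_of_le hs] at ht
          exact hC R t ht.1.le ht.2
      simpa [abs_of_nonneg hs] using this
    refine squeeze_zero_norm (a := fun R => 2 * C * s * (1 + R ^ 2)⁻¹) (fun R => ?_) ?_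
    · have hrect := integral_boundary_rect_eq_zero_of_differentiableOn f ⟨-R, 0⟩ ⟨R, s⟩
        (hf.mono fun v hv => by
          rw [mem_reProdIm, Set.uIcc_of_le (a := (0 : ℝ)) hs] at hv
          exact hv.2)
      simp only [ofReal_zero, zero_mul, add_zero, smul_eq_mul] at hrect
      have heq : (∫ y in (-R)..R, f y) - ∫ y in (-R)..R, f (y + s * I)
          = I * (∫ t in (0 : ℝ)..s, f ((-R : ℝ) + t * I))
            - I * ∫ t in (0 : ℝ)..s, f (R + t * I) := by
        linear_combination hrect
      rw [heq]
      refine (norm_sub_le _ _).trans ?_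
      rw [norm_mul, norm_mul, norm_I, one_mul, one_mul]
      have h1 := hside R
      have h2 := hside (-R)
      rw [neg_sq] at h2
      linarith
    · have : Tendsto (fun R : ℝ => (1 + R ^ 2)⁻¹) atTop (𝓝 0) :=
        tendsto_inv_atTop_zero.comp
          (tendsto_atTop_add_const_left _ _ (tendsto_pow_atTop two_ne_zero))
      simpa using this.const_mul (2 * C * s)
  exact sub_eq_zero.mp (tendsto_nhds_unique hlim hzero)

/-! ### The arctangent on the strip `|im v| < 1` -/

lemma one_add_mul_I_ne_zero {v : ℂ} (hv : |v.im| < 1) : 1 + v * I ≠ 0 := fun h => by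
  have := congrArg re h
  simp at this
  linarith [(abs_lt.mp hv).2]

lemma one_sub_mul_I_ne_zero {v : ℂ} (hv : |v.im| < 1) : 1 - v * I ≠ 0 := fun h => by
  have := congrArg re h
  simp at this
  linarith [(abs_lt.mp hv).1]

lemma one_add_sq_eq_mul (v : ℂ) : 1 + v ^ 2 = (1 + v * I) * (1 - v * I) := by
  linear_combination v ^ 2 * I_sq

lemma one_add_sq_ne_zero {v : ℂ} (hv : |v.im| < 1) : 1 + v ^ 2 ≠ 0 := by
  rw [one_add_sq_eq_mul]
  exact mul_ne_zero (one_add_mul_I_ne_zero hv) (one_sub_mul_I_ne_zero hv)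

lemma one_add_mul_I_div_mem_slitPlane {v : ℂ} (hv : |v.im| < 1) :
    (1 + v * I) / (1 - v * I) ∈ slitPlane := by
  have hn : 0 < normSq (1 - v * I) := normSq_pos.mpr (one_sub_mul_I_ne_zero hv)
  obtain ⟨h1, h2⟩ := abs_lt.mp hv
  rw [mem_slitPlane_iff]
  by_cases hre : v.re = 0
  · left
    rw [div_re, ← add_div]
    refine div_pos ?_ hn
    simp [hre]
    nlinarith
  · right
    rw [div_im, ← sub_div]
    refine div_ne_zero ?_ hn.ne'
    simp
    intro h
    apply hre
    linarith

lemma hasDerivAt_arctan {v : ℂ} (hv : |v.im| < 1) : HasDerivAt arctan (1 / (1 + v ^ 2)) v := by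
  have h1 := one_add_mul_I_ne_zero hv
  have h2 := one_sub_mul_I_ne_zero hv
  have hd : HasDerivAt (fun v : ℂ => (1 + v * I) / (1 - v * I))
      ((I * (1 - v * I) - (1 + v * I) * (-I)) / (1 - v * I) ^ 2) v := by
    refine HasDerivAt.div ?_ ?_ h2
    · simpa using ((hasDerivAt_id v).mul_const I).const_add 1
    · simpa using ((hasDerivAt_id v).mul_const I).const_sub 1
  refine ((hd.clog (one_add_mul_I_div_mem_slitPlane hv)).const_mul (-I / 2)).congr_deriv ?_
  rw [one_add_sq_eq_mul]
  field_simp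
  ring_nf
  simp [I_sq]

lemma im_arctan_add_mul_I {y t : ℝ} (ht : |t| < 1) :
    (arctan (y + t * I)).im
      = 1 / 4 * Real.log (((1 + t) ^ 2 + y ^ 2) / ((1 - t) ^ 2 + y ^ 2)) := by
  obtain ⟨h1, h2⟩ := abs_lt.mp ht
  have h3 : 0 < (1 + t) ^ 2 + y ^ 2 := by nlinarith
  have h4 : 0 < (1 - t) ^ 2 + y ^ 2 := by nlinarith
  have hlog : (arctan (y + t * I)).im = -(1 / 2) *
      Real.log ‖(1 + (y + t * I) * I) / (1 - (y + t * I) * I)‖ := by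
    rw [arctan, mul_im, log_re]
    simp
    ring
  have e1 : normSq (1 + (y + t * I) * I) = (1 - t) ^ 2 + y ^ 2 := by
    simp [normSq_apply]; ring
  have e2 : normSq (1 - (y + t * I) * I) = (1 + t) ^ 2 + y ^ 2 := by
    simp [normSq_apply]; ring
  rw [hlog, norm_div, norm_def, norm_def, e1, e2, ← Real.sqrt_div' _ h3.le,
    Real.log_sqrt (by positivity), Real.log_div h4.ne' h3.ne', Real.log_div h3.ne' h4.ne']
  ring

/-- Along a horizontal line in the upper half of the strip the imaginary part of `arctan` decreases
away from the imaginary axis. -/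
lemma im_arctan_le {y y' t : ℝ} (h0 : 0 ≤ t) (h1 : t < 1) (hy : y ^ 2 ≤ y' ^ 2) :
    (arctan (y' + t * I)).im ≤ (arctan (y + t * I)).im := by
  have ht : |t| < 1 := by rwa [abs_of_nonneg h0]
  rw [im_arctan_add_mul_I ht, im_arctan_add_mul_I ht]
  have h4 : 0 < (1 - t) ^ 2 + y ^ 2 := by nlinarith
  have h5 : 0 < (1 - t) ^ 2 + y' ^ 2 := by nlinarith
  refine mul_le_mul_of_nonneg_left (Real.log_le_log (by positivity) ?_) (by norm_num)
  rw [div_le_div_iff₀ h5 h4]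
  nlinarith [mul_nonneg h0 (sub_nonneg.mpr hy)]

lemma im_arctan_lt {y y' t : ℝ} (h0 : 0 < t) (h1 : t < 1) (hy : y ^ 2 < y' ^ 2) :
    (arctan (y' + t * I)).im < (arctan (y + t * I)).im := by
  have ht : |t| < 1 := by rwa [abs_of_pos h0]
  rw [im_arctan_add_mul_I ht, im_arctan_add_mul_I ht]
  have h4 : 0 < (1 - t) ^ 2 + y ^ 2 := by nlinarith
  have h5 : 0 < (1 - t) ^ 2 + y' ^ 2 := by nlinarith
  refine mul_lt_mul_of_pos_left (Real.log_lt_log (by positivity) ?_) (by norm_num)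
  rw [div_lt_div_iff₀ h5 h4]
  nlinarith [mul_pos h0 (sub_pos.mpr hy)]

lemma im_arctan_mul_I {t : ℝ} (ht : |t| < 1) : (arctan (t * I)).im = Real.artanh t := by
  obtain ⟨h1, h2⟩ := abs_lt.mp ht
  have h := im_arctan_add_mul_I (y := 0) ht
  rw [ofReal_zero, zero_add] at h
  rw [h, Real.artanh_eq_half_log ⟨h1.le, h2.le⟩, zero_pow two_ne_zero, add_zero, add_zero,
    ← div_pow, Real.log_pow]
  push_cast
  ring

/-! ### The integrand in the variable `v = tan u` -/

/-- The integrand `exp (i x (v - a arctan v)) / (1 + v²)` that the substitution `v = tan u` produces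
from `exp (x ψ(u)) du`; it is holomorphic on the strip `|im v| < 1`. -/
noncomputable def batemanIntegrand (a x : ℝ) (v : ℂ) : ℂ :=
  exp (x * (I * (v - a * arctan v))) / (1 + v ^ 2)

lemma differentiableAt_batemanIntegrand (a x : ℝ) {v : ℂ} (hv : |v.im| < 1) :
    DifferentiableAt ℂ (batemanIntegrand a x) v := by
  have h := (hasDerivAt_arctan hv).differentiableAt
  have h' := one_add_sq_ne_zero hv
  unfold batemanIntegrand
  fun_prop (disch := assumption)

lemma norm_one_add_sq_ge {y t : ℝ} (h0 : 0 ≤ t) (h1 : t < 1) :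
    (1 - t) ^ 2 * (1 + y ^ 2) ≤ ‖1 + ((y : ℂ) + t * I) ^ 2‖ := by
  have e1 : normSq (1 + (y + t * I) * I) = (1 - t) ^ 2 + y ^ 2 := by
    simp [normSq_apply]; ring
  have e2 : normSq (1 - (y + t * I) * I) = (1 + t) ^ 2 + y ^ 2 := by
    simp [normSq_apply]; ring
  have hl : ∀ r : ℝ, (1 - t) ^ 2 * (1 + y ^ 2) ≤ r → Real.sqrt ((1 - t) ^ 2 * (1 + y ^ 2)) ≤ √r :=
    fun r h => Real.sqrt_le_sqrt h
  have hy := sq_nonneg y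
  have hlt : (1 - t) ^ 2 ≤ 1 := by nlinarith
  rw [one_add_sq_eq_mul, norm_mul, norm_def, norm_def, e1, e2,
    ← Real.mul_self_sqrt (show 0 ≤ (1 - t) ^ 2 * (1 + y ^ 2) by positivity)]
  refine mul_le_mul (hl _ ?_) (hl _ ?_) (Real.sqrt_nonneg _) (Real.sqrt_nonneg _) <;> nlinarith

lemma norm_batemanIntegrand_le (a x : ℝ) {y t : ℝ} (h0 : 0 ≤ t) (h1 : t < 1) :
    ‖batemanIntegrand a x (y + t * I)‖
      ≤ Real.exp (-x * (t - a * (arctan (y + t * I)).im)) * (((1 - t) ^ 2)⁻¹ * (1 + y ^ 2)⁻¹) := by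
  have hre : (x * (I * ((y + t * I) - a * arctan (y + t * I)))).re
      = -x * (t - a * (arctan (y + t * I)).im) := by
    simp
    ring
  have h2 : 0 < 1 - t := by linarith
  rw [batemanIntegrand, norm_div, norm_exp, hre, ← mul_inv, div_eq_mul_inv]
  gcongr
  exact norm_one_add_sq_ge h0 h1

/-- The line of integration can be moved up to the height of the saddle point. -/
lemma integral_batemanIntegrand_eq {a x s : ℝ} (ha : 0 ≤ a) (hx : 0 ≤ x) (h0 : 0 ≤ s)
    (h1 : s < 1) :
    ∫ y : ℝ, batemanIntegrand a x y = ∫ y : ℝ, batemanIntegrand a x (y + s * I) := by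
  refine integral_eq_integral_add_mul_I h0
    (C := Real.exp (x * (a * Real.artanh s)) * ((1 - s) ^ 2)⁻¹)
    (fun v hv => (differentiableAt_batemanIntegrand a x
      (by rw [abs_of_nonneg hv.1]; exact hv.2.trans_lt h1)).differentiableWithinAt)
    fun y t ht0 hts => ?_
  have ht1 : t < 1 := hts.trans_lt h1
  have hs : 0 < 1 - s := by linarith
  refine (norm_batemanIntegrand_le a x ht0 ht1).trans ?_
  have him : (arctan (y + t * I)).im ≤ Real.artanh s := by
    have h := im_arctan_le (y := 0) (y' := y) ht0 ht1 (by simpa using sq_nonneg y)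
    rw [ofReal_zero, zero_add, im_arctan_mul_I (by rwa [abs_of_nonneg ht0])] at h
    exact h.trans (Real.artanh_le_artanh (by linarith) h1 hts)
  rw [mul_assoc]
  refine mul_le_mul (Real.exp_le_exp.mpr ?_) (mul_le_mul_of_nonneg_right (inv_anti₀ (by positivity)
    (pow_le_pow_left₀ hs.le (by linarith) 2)) (by positivity)) (by positivity) (Real.exp_pos _).le
  have := mul_le_mul_of_nonneg_left him ha
  nlinarith [mul_nonneg hx ht0, mul_le_mul_of_nonneg_left this hx]

lemma integrable_batemanIntegrand (a x : ℝ) {s : ℝ} (ha : 0 ≤ a) (hx : 0 ≤ x) (h0 : 0 ≤ s)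
    (h1 : s < 1) :
    Integrable fun y : ℝ => batemanIntegrand a x (y + s * I) := by
  have hdom := (integrable_inv_one_add_sq.const_mul ((1 - s) ^ 2)⁻¹).const_mul
    (Real.exp (-x * (s - a * Real.artanh s)))
  refine hdom.mono' (Continuous.aestronglyMeasurable ?_) (Eventually.of_forall fun y => ?_)
  · rw [continuous_iff_continuousAt]
    intro y
    refine ContinuousAt.comp (f := fun y : ℝ => (y : ℂ) + s * I)
      (differentiableAt_batemanIntegrand a x ?_).continuousAt (by fun_prop)
    simpa [abs_of_nonneg h0] using h1
  · refine (norm_batemanIntegrand_le a x h0 h1).trans ?_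
    have h := im_arctan_le (y := 0) (y' := y) h0 h1 (by simpa using sq_nonneg y)
    rw [ofReal_zero, zero_add, im_arctan_mul_I (by rwa [abs_of_nonneg h0])] at h
    gcongr ?_ * _
    refine Real.exp_le_exp.mpr ?_
    nlinarith [mul_le_mul_of_nonneg_left (mul_le_mul_of_nonneg_left h ha) hx]

/-- Away from the saddle point `i s` the integrand on the line `im v = s` is exponentially smaller
than at the saddle point. -/
lemma exists_norm_integral_compl_le {a s ε : ℝ} (ha : 0 < a) (h0 : 0 < s) (h1 : s < 1)
    (hε : 0 < ε) :
    ∃ C η : ℝ, 0 < η ∧ ∀ x : ℝ, 0 ≤ x →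
      ‖∫ y in (Set.Ioc (-ε) ε)ᶜ, batemanIntegrand a x (y + s * I)‖
        ≤ C * Real.exp (-x * (s - a * Real.artanh s + η)) := by
  have hlt := im_arctan_lt (y := 0) (y' := ε) h0 h1 (by simpa using pow_pos hε 2)
  rw [ofReal_zero, zero_add, im_arctan_mul_I (by rwa [abs_of_pos h0])] at hlt
  refine ⟨∫ y in (Set.Ioc (-ε) ε)ᶜ, ((1 - s) ^ 2)⁻¹ * (1 + y ^ 2)⁻¹,
    a * (Real.artanh s - (arctan (ε + s * I)).im), mul_pos ha (sub_pos.mpr hlt), fun x hx => ?_⟩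
  have hdom := (integrable_inv_one_add_sq.const_mul ((1 - s) ^ 2)⁻¹).const_mul
    (Real.exp (-x * (s - a * (arctan (ε + s * I)).im)))
  rw [show s - a * Real.artanh s + a * (Real.artanh s - (arctan (ε + s * I)).im)
    = s - a * (arctan (ε + s * I)).im by ring, mul_comm (integral _ _),
    ← integral_const_mul]
  refine norm_integral_le_of_norm_le hdom.integrableOn
    (ae_restrict_of_forall_mem measurableSet_Ioc.compl fun y hy => ?_)
  refine (norm_batemanIntegrand_le a x h0.le h1).trans ?_
  have hy' : ε ^ 2 ≤ y ^ 2 := by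
    rw [Set.mem_compl_iff, Set.mem_Ioc, not_and_or, not_lt, not_le] at hy
    rcases hy with hy | hy <;> nlinarith
  have h := im_arctan_le h0.le h1 hy'
  gcongr ?_ * _
  refine Real.exp_le_exp.mpr ?_
  nlinarith [mul_le_mul_of_nonneg_left (mul_le_mul_of_nonneg_left h ha.le) hx]

/-- The substitution `v = tan u` in the integral defining the Bateman function. -/
lemma batemanK_eq (a x : ℝ) (ha : 0 ≤ a) (hx : 0 ≤ x) :
    batemanK (a * x) x = 1 / Real.pi * (∫ y : ℝ, batemanIntegrand a x y).re := by
  have hi : Integrable fun y : ℝ => batemanIntegrand a x y := by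
    simpa using integrable_batemanIntegrand a x ha hx le_rfl one_pos
  set F : ℝ → ℝ := fun y => Real.cos (x * y - a * x * Real.arctan y) * (1 + y ^ 2)⁻¹ with hF
  have hre : (∫ y : ℝ, batemanIntegrand a x y).re = ∫ y : ℝ, F y := by
    rw [← reCLM_apply, ← reCLM.integral_comp_comm hi]
    congr 1; funext y
    rw [reCLM_apply, batemanIntegrand, ← ofReal_arctan,
      show (x : ℂ) * (I * (y - a * Real.arctan y))
        = ((x * y - a * x * Real.arctan y : ℝ) : ℂ) * I by push_cast; ring,
      show (1 : ℂ) + (y : ℂ) ^ 2 = ((1 + y ^ 2 : ℝ) : ℂ) by push_cast; ring, div_ofReal_re,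
      exp_ofReal_mul_I_re, div_eq_mul_inv]
  have heven : ∫ y : ℝ, F y = ∫ y : ℝ, F |y| := by
    congr 1; funext y
    rcases abs_choice y with h | h
    · rw [h]
    · rw [h, hF]
      simp only [Real.arctan_neg, neg_sq]
      rw [← Real.cos_neg]
      congr 2; ring
  have himage : Real.arctan '' Set.Ioi 0 = Set.Ioo 0 (Real.pi / 2) := by
    ext u
    constructor
    · rintro ⟨y, hy, rfl⟩
      exact ⟨Real.arctan_pos.mpr hy, Real.arctan_lt_pi_div_two y⟩
    · rintro ⟨h0, h1⟩
      exact ⟨Real.tan u, Real.tan_pos_of_pos_of_lt_pi_div_two h0 h1,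
        Real.arctan_tan (by linarith [Real.pi_pos]) h1⟩
  have hsub := integral_image_eq_integral_abs_deriv_smul (s := Set.Ioi 0) measurableSet_Ioi
    (fun y _ => (Real.hasDerivAt_arctan' y).hasDerivWithinAt) Real.arctan_injective.injOn
    (fun u => Real.cos (x * Real.tan u - a * x * u))
  rw [himage, ← integral_Ioc_eq_integral_Ioo,
    ← intervalIntegral.integral_of_le (by positivity)] at hsub
  rw [hre, heven, integral_comp_abs, batemanK, hsub]
  have hcongr : ∀ y : ℝ, |(1 + y ^ 2)⁻¹| • Real.cos (x * Real.tan (Real.arctan y)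
      - a * x * Real.arctan y) = F y := fun y => by
    rw [Real.tan_arctan, abs_of_nonneg (by positivity), smul_eq_mul, mul_comm]
  simp_rw [hcongr]
  ring

end Bateman

namespace Bateman

open Complex

/-! ### The saddle point -/

section Saddle

variable {a : ℝ}

lemma sqrt_mem_Ioo (ha0 : 0 < a) (ha1 : a < 1) : √(1 - a) ∈ Set.Ioo (0 : ℝ) 1 := by
  refine ⟨Real.sqrt_pos.mpr (by linarith), ?_⟩
  rw [Real.sqrt_lt' one_pos]
  linarith

lemma sqrt_mem_Ioo_neg_one (ha0 : 0 < a) (ha1 : a < 1) : √(1 - a) ∈ Set.Ioo (-1 : ℝ) 1 :=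
  ⟨by linarith [(sqrt_mem_Ioo ha0 ha1).1], (sqrt_mem_Ioo ha0 ha1).2⟩

lemma sq_sqrt_one_sub (ha1 : a < 1) : ((√(1 - a) : ℝ) : ℂ) ^ 2 = 1 - a := by
  rw [← ofReal_pow, Real.sq_sqrt (by linarith)]
  push_cast; rfl

lemma tan_batemanSaddle (ha0 : 0 < a) (ha1 : a < 1) :
    tan (batemanSaddle a) = (√(1 - a) : ℝ) * I := by
  rw [batemanSaddle, mul_comm, tan_mul_I, ← ofReal_tanh,
    Real.tanh_artanh (sqrt_mem_Ioo_neg_one ha0 ha1)]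

lemma cos_batemanSaddle_ne_zero (ha0 : 0 < a) (ha1 : a < 1) : cos (batemanSaddle a) ≠ 0 :=
  fun h => by
    -- the junk value `tan u = sin u / 0 = 0` differs from `i √(1 - a)`
    have h1 := tan_batemanSaddle ha0 ha1
    rw [tan, h, div_zero] at h1
    refine (mul_ne_zero ?_ I_ne_zero) h1.symm
    exact ofReal_ne_zero.mpr (sqrt_mem_Ioo ha0 ha1).1.ne'

lemma hasDerivAt_tan' {z : ℂ} (hz : cos z ≠ 0) : HasDerivAt tan (1 + tan z ^ 2) z := by
  refine (Complex.hasDerivAt_tan hz).congr_deriv ?_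
  rw [tan]
  field_simp
  linear_combination -(sin_sq_add_cos_sq z)

lemma analyticAt_tan {z : ℂ} (hz : cos z ≠ 0) : AnalyticAt ℂ tan z :=
  (analyticAt_sin.div analyticAt_cos hz).congr (Eventually.of_forall fun _ => rfl)

lemma hasDerivAt_batemanPhase (a : ℝ) {z : ℂ} (hz : cos z ≠ 0) :
    HasDerivAt (batemanPhase a) (I * (1 + tan z ^ 2 - a)) z := by
  refine (((hasDerivAt_tan' hz).sub ((hasDerivAt_id z).const_mul (a : ℂ))).const_mul I).congr_deriv
    ?_
  simp

lemma analyticAt_batemanPhase (a : ℝ) {z : ℂ} (hz : cos z ≠ 0) :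
    AnalyticAt ℂ (batemanPhase a) z := by
  have := analyticAt_tan hz
  unfold batemanPhase
  fun_prop

lemma hasDerivAt_batemanPhase_saddle (ha0 : 0 < a) (ha1 : a < 1) :
    HasDerivAt (batemanPhase a) 0 (batemanSaddle a) := by
  refine (hasDerivAt_batemanPhase a (cos_batemanSaddle_ne_zero ha0 ha1)).congr_deriv ?_
  rw [tan_batemanSaddle ha0 ha1, mul_pow, sq_sqrt_one_sub ha1, I_sq]
  ring

lemma hasDerivAt_batemanPhase_neg_saddle (ha0 : 0 < a) (ha1 : a < 1) :
    HasDerivAt (batemanPhase a) 0 (-batemanSaddle a) := by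
  refine (hasDerivAt_batemanPhase a (z := -batemanSaddle a)
    (by rw [cos_neg]; exact cos_batemanSaddle_ne_zero ha0 ha1)).congr_deriv ?_
  rw [tan_neg, neg_sq, tan_batemanSaddle ha0 ha1, mul_pow, sq_sqrt_one_sub ha1, I_sq]
  ring

lemma batemanPhase_saddle (ha0 : 0 < a) (ha1 : a < 1) :
    batemanPhase a (batemanSaddle a) = ((-batemanPsi a : ℝ) : ℂ) := by
  rw [batemanPhase, tan_batemanSaddle ha0 ha1, batemanSaddle, batemanPsi]
  push_cast
  linear_combination ((√(1 - a) : ℝ) - a * (Real.artanh (√(1 - a)) : ℂ)) * I_sq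

/-- With `t = arctanh √(1 - a)` the claim is `2 t < sinh (2 t)`. -/
lemma batemanPsi_pos (ha0 : 0 < a) (ha1 : a < 1) : 0 < batemanPsi a := by
  have hs := sqrt_mem_Ioo ha0 ha1
  have hs' := sqrt_mem_Ioo_neg_one ha0 ha1
  have h := Real.self_lt_sinh_iff.mpr
    (mul_pos two_pos (Real.artanh_pos hs))
  have hsq : 1 - √(1 - a) ^ 2 = a := by rw [Real.sq_sqrt (by linarith)]; ring
  rw [Real.sinh_two_mul, Real.sinh_artanh hs', Real.cosh_artanh hs', hsq, mul_assoc,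
    div_mul_div_comm, mul_one, Real.mul_self_sqrt ha0.le] at h
  rw [batemanPsi]
  have h2 := mul_lt_mul_of_pos_left h ha0
  have h3 : a * (2 * (√(1 - a) / a)) = 2 * √(1 - a) := by field_simp
  linarith

/-- At the saddle point the phase has an exact double zero: after subtracting its value there, it
equals `-(u - u₀)² g(u)` with `g(u₀) = a √(1 - a)`, half of `-ψ''(u₀)`. -/
lemma exists_batemanPhase_factor (ha0 : 0 < a) (ha1 : a < 1) :
    ∃ g : ℂ → ℂ, AnalyticAt ℂ g (batemanSaddle a) ∧
      g (batemanSaddle a) = ((a * √(1 - a) : ℝ) : ℂ) ∧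
      ∀ᶠ z in 𝓝 (batemanSaddle a), batemanPhase a z - batemanPhase a (batemanSaddle a)
        = -((z - batemanSaddle a) ^ 2 * g z) := by
  have hcos := cos_batemanSaddle_ne_zero ha0 ha1
  set u₀ := batemanSaddle a with hu₀
  set f : ℂ → ℂ := fun z => batemanPhase a u₀ - batemanPhase a z with hf
  have hfa : AnalyticAt ℂ f u₀ := analyticAt_const.sub (analyticAt_batemanPhase a hcos)
  have hder : HasDerivAt f 0 u₀ := by
    simpa using (hasDerivAt_batemanPhase_saddle ha0 ha1).const_sub (batemanPhase a u₀)
  have hord : ((2 : ℕ) : ℕ∞) ≤ analyticOrderAt f u₀ := by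
    rw [natCast_le_analyticOrderAt_iff_iteratedDeriv_eq_zero hfa]
    intro i hi
    interval_cases i
    · simp [hf]
    · rw [iteratedDeriv_one]
      exact hder.deriv
  obtain ⟨g, hg, hfg⟩ := (natCast_le_analyticOrderAt hfa).mp hord
  refine ⟨g, hg, ?_, hfg.mono fun z hz => ?_⟩
  · have hcos' : ∀ᶠ z in 𝓝 u₀, cos z ≠ 0 :=
      continuous_cos.continuousAt.eventually_ne hcos
    have h1 : deriv f =ᶠ[𝓝 u₀] fun z => -(I * (1 + tan z ^ 2 - a)) := by
      filter_upwards [hcos'] with z hz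
      exact ((hasDerivAt_batemanPhase a hz).const_sub _).deriv
    have h2 : deriv f =ᶠ[𝓝 u₀] fun z => 2 * (z - u₀) * g z + (z - u₀) ^ 2 * deriv g z := by
      filter_upwards [hfg.eventually_nhds, hg.eventually_analyticAt] with z hz hgz
      rw [EventuallyEq.deriv_eq hz]
      have : HasDerivAt (fun z => (z - u₀) ^ 2 • g z)
          (2 * (z - u₀) * g z + (z - u₀) ^ 2 * deriv g z) z := by
        refine ((((hasDerivAt_id z).sub_const u₀).pow 2).smul
          hgz.differentiableAt.hasDerivAt).congr_deriv ?_
        simp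
        ring
      exact this.deriv
    have h3 : HasDerivAt (fun z => -(I * (1 + tan z ^ 2 - a)))
        (-(I * (2 * tan u₀ * (1 + tan u₀ ^ 2)))) u₀ := by
      refine (((((hasDerivAt_tan' hcos).pow 2).const_add 1).sub_const (a : ℂ)).const_mul
        I).neg.congr_deriv ?_
      simp
    have h4 : HasDerivAt (fun z => 2 * (z - u₀) * g z + (z - u₀) ^ 2 * deriv g z)
        (2 * g u₀) u₀ := by
      refine (((((hasDerivAt_id u₀).sub_const u₀).const_mul 2).mul
        hg.differentiableAt.hasDerivAt).add ((((hasDerivAt_id u₀).sub_const u₀).pow 2).mul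
          hg.deriv.differentiableAt.hasDerivAt)).congr_deriv ?_
      simp
    have h5 := (h3.congr_of_eventuallyEq h1).unique (h4.congr_of_eventuallyEq h2)
    rw [tan_batemanSaddle ha0 ha1] at h5
    push_cast
    linear_combination (-1 / 2 : ℂ) * h5 - (√(1 - a) : ℝ) * (sq_sqrt_one_sub ha1)
      - ((√(1 - a) : ℝ) + (√(1 - a) : ℝ) ^ 3 * (I ^ 2 - 1)) * I_sq
  · simp only [hf, smul_eq_mul] at hz
    linear_combination -hz

/-- The square root of the factored phase is a local coordinate `w` at the saddle point, and `u(w)`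
is its analytic local inverse. -/
lemma exists_isSaddleInversion (ha0 : 0 < a) (ha1 : a < 1) :
    ∃ u : ℂ → ℂ, IsSaddleInversion a u := by
  obtain ⟨g, hg, hg0, hphase⟩ := exists_batemanPhase_factor ha0 ha1
  set u₀ := batemanSaddle a with hu₀
  have hpos : 0 < a * √(1 - a) := mul_pos ha0 (sqrt_mem_Ioo ha0 ha1).1
  set q : ℂ → ℂ := fun z => exp (log (g z) / 2) with hq
  have hqa : AnalyticAt ℂ q u₀ := by
    have : AnalyticAt ℂ (fun z => log (g z)) u₀ :=
      hg.clog (by rw [hg0]; exact ofReal_mem_slitPlane.mpr hpos)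
    rw [hq]
    fun_prop
  have hq0 : q u₀ = (Real.exp (Real.log (a * √(1 - a)) / 2) : ℝ) := by
    rw [hq]
    simp only
    rw [hg0, ← ofReal_log hpos.le]
    push_cast; rfl
  set w : ℂ → ℂ := fun z => (z - u₀) * q z with hw
  have hwa : AnalyticAt ℂ w u₀ := by
    rw [hw]
    fun_prop
  have hwd : deriv w u₀ = q u₀ := by
    have : HasDerivAt w (1 * q u₀ + (u₀ - u₀) * deriv q u₀) u₀ :=
      ((hasDerivAt_id u₀).sub_const u₀).mul hqa.differentiableAt.hasDerivAt
    simpa using this.deriv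
  have hwd0 : deriv w u₀ ≠ 0 := by
    rw [hwd, hq]
    exact exp_ne_zero _
  have hw0 : w u₀ = 0 := by simp [hw]
  set u := hwa.hasStrictDerivAt.localInverse w _ u₀ hwd0 with hu
  have hua : AnalyticAt ℂ u 0 := by
    have := hwa.analyticAt_localInverse hwd0
    rwa [hw0] at this
  have hu0 : u 0 = u₀ := by
    rw [← hw0]
    exact HasStrictFDerivAt.localInverse_apply_image ..
  have hinv : ∀ᶠ z in 𝓝 (0 : ℂ), w (u z) = z := by
    have := hwa.hasStrictDerivAt.eventually_right_inverse hwd0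
    rwa [hw0] at this
  refine ⟨u, hua, hu0, ?_, (Real.exp (Real.log (a * √(1 - a)) / 2))⁻¹, by positivity, ?_⟩
  · have hut : Tendsto u (𝓝 0) (𝓝 u₀) := hu0 ▸ hua.continuousAt.tendsto
    have hgne : ∀ᶠ z in 𝓝 u₀, g z ≠ 0 := hg.continuousAt.eventually_ne
      (by rw [hg0]; exact ofReal_ne_zero.mpr hpos.ne')
    filter_upwards [hinv, hut.eventually hphase, hut.eventually hgne] with z h1 h2 h3
    have hsq : q (u z) ^ 2 = g (u z) := by
      rw [hq]
      simp only
      rw [← exp_nat_mul, Nat.cast_ofNat, mul_div_cancel₀ _ two_ne_zero, exp_log h3]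
    rw [h2, ← hsq, ← mul_pow]
    exact congrArg (fun t => -t ^ 2) h1
  · have := (hwa.hasStrictDerivAt.to_localInverse hwd0).hasDerivAt.deriv
    rw [hw0] at this
    rw [this, hwd, hq0]
    push_cast; rfl

end Saddle

end Bateman

namespace Bateman

open PowerSeries

/-! ### Taylor series at the origin -/

/-- The Taylor series at `0` of a function of a complex variable, as a formal power series. -/
noncomputable def taylorSeries (f : ℂ → ℂ) : ℂ⟦X⟧ :=
  PowerSeries.mk fun n => iteratedDeriv n f 0 / (n.factorial : ℂ)

lemma taylorSeries_congr {f g : ℂ → ℂ} (h : f =ᶠ[𝓝 0] g) : taylorSeries f = taylorSeries g := by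
  ext n
  rw [taylorSeries, taylorSeries, coeff_mk, coeff_mk, h.iteratedDeriv_eq]

lemma taylorSeries_const (c : ℂ) : taylorSeries (fun _ => c) = C c := by
  ext n
  rw [taylorSeries, coeff_mk, iteratedDeriv_const, coeff_C]
  split_ifs with h <;> simp [h]

lemma taylorSeries_id : taylorSeries (fun w => w) = X := by
  ext n
  rw [taylorSeries, coeff_mk, coeff_X]
  rcases n with _ | _ | n
  · simp
  · simp
  · simp [iteratedDeriv_succ']

lemma taylorSeries_add {f g : ℂ → ℂ} (hf : AnalyticAt ℂ f 0) (hg : AnalyticAt ℂ g 0) :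
    taylorSeries (fun w => f w + g w) = taylorSeries f + taylorSeries g := by
  ext n
  simp only [taylorSeries, coeff_mk, map_add]
  rw [← add_div]
  congr 1
  exact iteratedDeriv_add hf.contDiffAt hg.contDiffAt

lemma taylorSeries_mul {f g : ℂ → ℂ} (hf : AnalyticAt ℂ f 0) (hg : AnalyticAt ℂ g 0) :
    taylorSeries (fun w => f w * g w) = taylorSeries f * taylorSeries g := by
  ext n
  simp only [taylorSeries, coeff_mk, PowerSeries.coeff_mul,
    Finset.Nat.sum_antidiagonal_eq_sum_range_succ_mk]
  rw [show (fun w => f w * g w) = f * g from rfl, iteratedDeriv_mul hf.contDiffAt hg.contDiffAt,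
    Finset.sum_div]
  refine Finset.sum_congr rfl fun i hi => ?_
  rw [Nat.cast_choose _ (Nat.lt_succ_iff.mp (Finset.mem_range.mp hi))]
  field_simp [Nat.factorial_ne_zero]

lemma derivative_taylorSeries (f : ℂ → ℂ) : d⁄dX ℂ (taylorSeries f) = taylorSeries (deriv f) := by
  ext n
  rw [coeff_derivative, taylorSeries, taylorSeries, coeff_mk, coeff_mk, iteratedDeriv_succ',
    Nat.factorial_succ]
  push_cast
  have : (n : ℂ) + 1 ≠ 0 := Nat.cast_add_one_ne_zero n
  field_simp

/-! ### The formal differential equation at the saddle point -/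

section FormalODE

variable {K : Type*} [Field K]

lemma derivative_rescale (κ : K) (f : K⟦X⟧) :
    d⁄dX K (rescale κ f) = C κ * rescale κ (d⁄dX K f) := by
  ext n
  rw [coeff_derivative, coeff_C_mul, coeff_rescale, coeff_rescale, coeff_derivative]
  ring

lemma rescale_C (κ c : K) : rescale κ (C c) = C c := by
  ext n
  rw [coeff_rescale, coeff_C]
  split_ifs with h <;> simp [h]

/-- The equation `(Y' + c X) (2 Y + Y²) = 2 X` has at most one solution `Y = X + O(X²)`: if two
solutions agree below degree `n`, comparison of the coefficients of `X ^ n` gives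
`2 (n + 1)` times the difference of their `n`-th coefficients, and this vanishes. -/
lemma saddleSeries_unique [CharZero K] {c : K} {Y Z : K⟦X⟧}
    (hY0 : coeff 0 Y = 0) (hY1 : coeff 1 Y = 1)
    (hZ0 : coeff 0 Z = 0) (hZ1 : coeff 1 Z = 1)
    (hY : (d⁄dX K Y + C c * X) * (2 * Y + Y ^ 2) = 2 * X)
    (hZ : (d⁄dX K Z + C c * X) * (2 * Z + Z ^ 2) = 2 * X) : Y = Z := by
  have key : d⁄dX K (Y - Z) * (2 * Y + Y ^ 2)
      + (d⁄dX K Z + C c * X) * (2 + Y + Z) * (Y - Z) = 0 := by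
    rw [map_sub]
    linear_combination hY - hZ
  have hYX : X ∣ Y := X_dvd_iff.mpr (by simpa using hY0)
  obtain ⟨Y', hY'⟩ := hYX
  have hY'0 : constantCoeff Y' = 1 := by
    rw [hY', show 1 = 0 + 1 from rfl, coeff_succ_X_mul] at hY1
    simpa using hY1
  have hall : ∀ n, X ^ n ∣ Y - Z := by
    intro n
    induction n with
    | zero => simp
    | succ n ih =>
      rw [X_pow_dvd_iff] at ih ⊢
      intro m hm
      rcases Nat.lt_succ_iff_lt_or_eq.mp hm with h | rfl
      · exact ih m h
      rcases m with _ | _ | m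
      · simp only [map_sub, hY0, hZ0, sub_self]
      · simp only [map_sub, zero_add, hY1, hZ1, sub_self]
      obtain ⟨E, hE⟩ := X_pow_dvd_iff.mpr ih
      have hd : d⁄dX K (Y - Z) = X ^ (m + 1) * (((m + 2 : ℕ) : K⟦X⟧) * E + X * d⁄dX K E) := by
        rw [hE, Derivation.leibniz, Derivation.leibniz_pow, derivative_X]
        simp only [smul_eq_mul, nsmul_eq_mul]
        push_cast
        ring
      have h0 : X ^ (m + 2) * ((((m + 2 : ℕ) : K⟦X⟧) * E + X * d⁄dX K E) * Y' * (2 + Y)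
          + (d⁄dX K Z + C c * X) * (2 + Y + Z) * E) = 0 := by
        rw [hd] at key
        rw [hE] at key
        have hYY : 2 * Y + Y ^ 2 = X * Y' * (2 + Y) := by
          linear_combination (2 + Y) * hY'
        rw [hYY] at key
        linear_combination key
      have h1 := (mul_eq_zero.mp h0).resolve_left (pow_ne_zero _ X_ne_zero)
      have h2 := congrArg constantCoeff h1
      have hZd : constantCoeff (d⁄dX K Z) = 1 := by
        rw [← coeff_zero_eq_constantCoeff_apply, coeff_derivative]
        simpa using hZ1
      have hY00 : constantCoeff Y = 0 := by simpa using hY0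
      have hZ00 : constantCoeff Z = 0 := by simpa using hZ0
      simp only [map_add, map_mul, hY'0, hZd, hY00, hZ00, constantCoeff_X, map_natCast, map_ofNat,
        map_zero] at h2
      have h3 : (((m : K) + 3) * 2) * constantCoeff E = 0 := by
        push_cast at h2
        linear_combination h2
      have h4 : ((m : K) + 3) * 2 ≠ 0 := by
        refine mul_ne_zero ?_ two_ne_zero
        exact_mod_cast Nat.succ_ne_zero (m + 2)
      rw [hE, show m + 1 + 1 = m + 2 from rfl, coeff_X_pow_mul', if_pos le_rfl, Nat.sub_self,
        coeff_zero_eq_constantCoeff_apply]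
      exact (mul_eq_zero.mp h3).resolve_left h4
  ext n
  have := X_pow_dvd_iff.mp (hall (n + 1)) n n.lt_succ_self
  rwa [map_sub, sub_eq_zero] at this

/-- The odd coefficients of the solution `Y = X + O(X²)` of `(Y' + c X) (2 Y + Y²) = 2 X`, up to
degree `9`. -/
lemma saddleSeries_coeff [CharZero K] {c : K} {Y : K⟦X⟧} (hY0 : coeff 0 Y = 0) (hY1 : coeff 1 Y = 1)
    (hY : (d⁄dX K Y + C c * X) * (2 * Y + Y ^ 2) = 2 * X) :
    coeff 3 Y = 5 / 72 + c / 36 + c ^ 2 / 36 ∧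
    coeff 5 Y = 77 / 3456 + 77 / 4320 * c + c ^ 2 / 720 + c ^ 3 / 2160 + c ^ 4 / 4320 ∧
    coeff 7 Y = 2431 / 248832 + 2431 / 207360 * c + 29263 / 7257600 * c ^ 2 + 11 / 48600 * c ^ 3
      - 109 / 3628800 * c ^ 4 - 139 / 1814400 * c ^ 5 - 139 / 5443200 * c ^ 6 ∧
    coeff 9 Y = 1062347 / 214990848 + 1062347 / 134369280 * c + 518947 / 117573120 * c ^ 2
      + 314567 / 335923200 * c ^ 3 + 166069 / 4702924800 * c ^ 4 - 1283 / 1175731200 * c ^ 5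
      - 247 / 146966400 * c ^ 6 - 571 / 587865600 * c ^ 7 - 571 / 2351462400 * c ^ 8 := by
  set y : ℕ → K := fun n => coeff n Y with hy
  set q : ℕ → K := fun n => 2 * y n + ∑ k ∈ Finset.range (n + 1), y k * y (n - k) with hq
  have hqc : ∀ n, coeff n (2 * Y + Y ^ 2) = q n := fun n => by
    rw [map_add, show (2 : K⟦X⟧) = C 2 from (map_ofNat C 2).symm, coeff_C_mul, pow_two,
      PowerSeries.coeff_mul, Finset.Nat.sum_antidiagonal_eq_sum_range_succ_mk]
  have hrec : ∀ n, ∑ k ∈ Finset.range (n + 1), (y (k + 1) * (k + 1) + if k = 1 then c else 0)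
      * q (n - k) = if n = 1 then 2 else 0 := fun n => by
    have h := congrArg (coeff n) hY
    rw [PowerSeries.coeff_mul, Finset.Nat.sum_antidiagonal_eq_sum_range_succ_mk,
      show (2 : K⟦X⟧) * X = C 2 * X by rw [map_ofNat], coeff_C_mul, coeff_X] at h
    simpa [hqc, coeff_derivative, coeff_X] using h
  -- the coefficient of `X ^ n` is `2 (n + 1) y n` plus a polynomial in `c` and the `y k`, `k < n`
  have y0 : y 0 = 0 := hY0
  have y1 : y 1 = 1 := hY1
  have q0 : q 0 = 0 := by simp [hq, y0]
  have q1 : q 1 = 2 := by simp [hq, y0, y1, Finset.sum_range_succ]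
  have q2 : q 2 = 2 * y 2 + 1 := by
    simp only [hq, Finset.sum_range_succ, Finset.sum_range_zero, Nat.reduceSub, y0, y1]
    ring
  have r2 := hrec 2
  simp only [Finset.sum_range_succ, Finset.sum_range_zero, Nat.reduceSub, Nat.reduceAdd,
    Nat.reduceEqDiff, if_true, if_false, q2, q1, q0, y1] at r2
  have y2 : y 2 = -1 / 6 - 1 / 3 * c := by
    push_cast at r2
    linear_combination r2 / 6
  have q3 : q 3 = 2 * y 3 + 2 * y 2 := by
    simp only [hq, Finset.sum_range_succ, Finset.sum_range_zero, Nat.reduceSub, y0, y1]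
    ring
  have r3 := hrec 3
  simp only [Finset.sum_range_succ, Finset.sum_range_zero, Nat.reduceSub, Nat.reduceAdd,
    Nat.reduceEqDiff, if_true, if_false, q3, q2, q1, q0, y1, y2] at r3
  have y3 : y 3 = 5 / 72 + 1 / 36 * c + 1 / 36 * c ^ 2 := by
    push_cast at r3
    linear_combination r3 / 8
  have q4 : q 4 = 2 * y 4 + 2 * y 3 + y 2 ^ 2 := by
    simp only [hq, Finset.sum_range_succ, Finset.sum_range_zero, Nat.reduceSub, y0, y1]
    ring
  have r4 := hrec 4
  simp only [Finset.sum_range_succ, Finset.sum_range_zero, Nat.reduceSub, Nat.reduceAdd,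
    Nat.reduceEqDiff, if_true, if_false, q4, q3, q2, q1, q0, y1, y2, y3] at r4
  have y4 : y 4 = -1 / 27 - 1 / 45 * c + 1 / 180 * c ^ 2 + 1 / 270 * c ^ 3 := by
    push_cast at r4
    linear_combination r4 / 10
  have q5 : q 5 = 2 * y 5 + 2 * y 4 + 2 * y 2 * y 3 := by
    simp only [hq, Finset.sum_range_succ, Finset.sum_range_zero, Nat.reduceSub, y0, y1]
    ring
  have r5 := hrec 5
  simp only [Finset.sum_range_succ, Finset.sum_range_zero, Nat.reduceSub, Nat.reduceAdd,
    Nat.reduceEqDiff, if_true, if_false, q5, q4, q3, q2, q1, q0, y1, y2, y3, y4] at r5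
  have y5 : y 5 = 77 / 3456 + 77 / 4320 * c + 1 / 720 * c ^ 2 + 1 / 2160 * c ^ 3
      + 1 / 4320 * c ^ 4 := by
    push_cast at r5
    linear_combination r5 / 12
  have q6 : q 6 = 2 * y 6 + 2 * y 5 + 2 * y 2 * y 4 + y 3 ^ 2 := by
    simp only [hq, Finset.sum_range_succ, Finset.sum_range_zero, Nat.reduceSub, y0, y1]
    ring
  have r6 := hrec 6
  simp only [Finset.sum_range_succ, Finset.sum_range_zero, Nat.reduceSub, Nat.reduceAdd,
    Nat.reduceEqDiff, if_true, if_false, q6, q5, q4, q3, q2, q1, q0, y1, y2, y3, y4, y5] at r6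
  have y6 : y 6 = -7 / 486 - 7 / 486 * c - 221 / 68040 * c ^ 2 + 1 / 8505 * c ^ 3
      - 1 / 6804 * c ^ 4 - 1 / 17010 * c ^ 5 := by
    push_cast at r6
    linear_combination r6 / 14
  have q7 : q 7 = 2 * y 7 + 2 * y 6 + 2 * y 2 * y 5 + 2 * y 3 * y 4 := by
    simp only [hq, Finset.sum_range_succ, Finset.sum_range_zero, Nat.reduceSub, y0, y1]
    ring
  have r7 := hrec 7
  simp only [Finset.sum_range_succ, Finset.sum_range_zero, Nat.reduceSub, Nat.reduceAdd,
    Nat.reduceEqDiff, if_true, if_false, q7, q6, q5, q4, q3, q2, q1, q0, y1, y2, y3, y4, y5,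
    y6] at r7
  have y7 : y 7 = 2431 / 248832 + 2431 / 207360 * c + 29263 / 7257600 * c ^ 2
      + 11 / 48600 * c ^ 3 - 109 / 3628800 * c ^ 4 - 139 / 1814400 * c ^ 5
      - 139 / 5443200 * c ^ 6 := by
    push_cast at r7
    linear_combination r7 / 16
  have q8 : q 8 = 2 * y 8 + 2 * y 7 + 2 * y 2 * y 6 + 2 * y 3 * y 5 + y 4 ^ 2 := by
    simp only [hq, Finset.sum_range_succ, Finset.sum_range_zero, Nat.reduceSub, y0, y1]
    ring
  have r8 := hrec 8
  simp only [Finset.sum_range_succ, Finset.sum_range_zero, Nat.reduceSub, Nat.reduceAdd,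
    Nat.reduceEqDiff, if_true, if_false, q8, q7, q6, q5, q4, q3, q2, q1, q0, y1, y2, y3, y4, y5,
    y6, y7] at r8
  have y8 : y 8 = -5 / 729 - 7 / 729 * c - 37 / 8505 * c ^ 2 - 61 / 102060 * c ^ 3
      + 1 / 58320 * c ^ 4 - 1 / 68040 * c ^ 5 - 1 / 58320 * c ^ 6 - 1 / 204120 * c ^ 7 := by
    push_cast at r8
    linear_combination r8 / 18
  have q9 : q 9 = 2 * y 9 + 2 * y 8 + 2 * y 2 * y 7 + 2 * y 3 * y 6 + 2 * y 4 * y 5 := by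
    simp only [hq, Finset.sum_range_succ, Finset.sum_range_zero, Nat.reduceSub, y0, y1]
    ring
  have r9 := hrec 9
  simp only [Finset.sum_range_succ, Finset.sum_range_zero, Nat.reduceSub, Nat.reduceAdd,
    Nat.reduceEqDiff, if_true, if_false, q9, q8, q7, q6, q5, q4, q3, q2, q1, q0, y1, y2, y3, y4,
    y5, y6, y7, y8] at r9
  have y9 : y 9 = 1062347 / 214990848 + 1062347 / 134369280 * c + 518947 / 117573120 * c ^ 2
      + 314567 / 335923200 * c ^ 3 + 166069 / 4702924800 * c ^ 4 - 1283 / 1175731200 * c ^ 5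
      - 247 / 146966400 * c ^ 6 - 571 / 587865600 * c ^ 7 - 571 / 2351462400 * c ^ 8 := by
    push_cast at r9
    linear_combination r9 / 20
  exact ⟨y3.trans (by ring), y5.trans (by ring), y7.trans (by ring), y9.trans (by ring)⟩

end FormalODE

lemma map_starRingEnd_derivative (f : ℂ⟦X⟧) :
    PowerSeries.map (starRingEnd ℂ) (d⁄dX ℂ f) = d⁄dX ℂ (PowerSeries.map (starRingEnd ℂ) f) := by
  ext n
  simp [coeff_derivative]

lemma map_ofReal_derivative (f : ℝ⟦X⟧) :
    PowerSeries.map Complex.ofRealHom (d⁄dX ℝ f)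
      = d⁄dX ℂ (PowerSeries.map Complex.ofRealHom f) := by
  ext n
  simp [coeff_derivative]

/-- A complex solution for real `c` is real: its complex conjugate is a solution as well. -/
lemma exists_real_saddleSeries {c : ℝ} {Y : ℂ⟦X⟧} (hY0 : coeff 0 Y = 0) (hY1 : coeff 1 Y = 1)
    (hY : (d⁄dX ℂ Y + C (c : ℂ) * X) * (2 * Y + Y ^ 2) = 2 * X) :
    ∃ Z : ℝ⟦X⟧, PowerSeries.map Complex.ofRealHom Z = Y ∧ coeff 0 Z = 0 ∧ coeff 1 Z = 1 ∧
      (d⁄dX ℝ Z + C c * X) * (2 * Z + Z ^ 2) = 2 * X := by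
  have hconj : PowerSeries.map (starRingEnd ℂ) Y = Y := by
    refine saddleSeries_unique (c := (c : ℂ)) ?_ ?_ hY0 hY1 ?_ hY
    · rw [coeff_map, hY0, map_zero]
    · rw [coeff_map, hY1, map_one]
    · have h := congrArg (PowerSeries.map (starRingEnd ℂ)) hY
      simpa only [map_mul, map_add, map_pow, map_X, map_C, map_ofNat, map_starRingEnd_derivative,
        Complex.conj_ofReal] using h
  set Z : ℝ⟦X⟧ := PowerSeries.mk fun n => (coeff n Y).re with hZ
  have hZY : PowerSeries.map Complex.ofRealHom Z = Y := by
    ext n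
    have h := congrArg (coeff n) hconj
    rw [coeff_map] at h
    rw [coeff_map, hZ, coeff_mk]
    exact Complex.conj_eq_iff_re.mp h
  refine ⟨Z, hZY, by simp [hZ, hY0], by simp [hZ, hY1], ?_⟩
  refine PowerSeries.map_injective Complex.ofRealHom Complex.ofReal_injective ?_
  rw [map_mul, map_mul, map_add, map_add, map_mul, map_mul, map_pow, map_X, map_C, map_ofNat,
    map_ofReal_derivative, hZY]
  exact hY

/-- The Taylor series `T` of `tan (u w)` and `U` of `u' w` satisfy `T' = (1 + T²) U` and
`T' - a U = 2 i w`. Normalised to `T = i s (1 + Y (w / κ))` with `κ² = -s³ / a`, the series `Y`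
solves the equation `(Y' + c X) (2 Y + Y²) = 2 X` with `c = 2 (1 - a) / a`. -/
lemma exists_saddleSeries {a s r : ℝ} (ha : 0 < a) (hs : 0 < s) (hs2 : s ^ 2 = 1 - a) (hr : 0 < r)
    {T U : ℂ⟦X⟧} (hT0 : coeff 0 T = s * Complex.I) (hU0 : coeff 0 U = r)
    (h1 : d⁄dX ℂ T = (1 + T ^ 2) * U) (h2 : d⁄dX ℂ T - C (a : ℂ) * U = C (2 * Complex.I) * X) :
    a * s * r ^ 2 = 1 ∧ ∃ Z : ℝ⟦X⟧, coeff 0 Z = 0 ∧ coeff 1 Z = 1 ∧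
      (d⁄dX ℝ Z + C (2 * (1 - a) / a) * X) * (2 * Z + Z ^ 2) = 2 * X ∧
      ∀ k : ℕ, coeff (2 * k) U
        = ((r * ((2 * k + 1) * coeff (2 * k + 1) Z * (-a / s ^ 3) ^ k) : ℝ) : ℂ) := by
  have haC : (a : ℂ) ≠ 0 := Complex.ofReal_ne_zero.mpr ha.ne'
  have hsC : (s : ℂ) ≠ 0 := Complex.ofReal_ne_zero.mpr hs.ne'
  have hrC : (r : ℂ) ≠ 0 := Complex.ofReal_ne_zero.mpr hr.ne'
  have hs2C : (s : ℂ) ^ 2 = 1 - a := by exact_mod_cast hs2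
  have hT1 : coeff 1 T = a * r := by
    have h := congrArg (coeff 0) h2
    rw [map_sub, coeff_derivative, coeff_C_mul, hU0, coeff_C_mul, coeff_zero_X] at h
    simp at h
    linear_combination h
  set P : ℂ⟦X⟧ := T - C (s * Complex.I) with hP
  have hP0 : coeff 0 P = 0 := by rw [hP, map_sub, hT0, coeff_zero_C, sub_self]
  have hP1 : coeff 1 P = a * r := by rw [hP, map_sub, hT1, coeff_C]; simp
  have hPd : d⁄dX ℂ P = d⁄dX ℂ T := by rw [hP, map_sub, derivative_C, sub_zero]
  have hTP : T = P + C (s * Complex.I) := by rw [hP]; ring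
  have hCsq : C (s * Complex.I) ^ 2 = C (a : ℂ) - 1 := by
    rw [← map_pow, mul_pow, Complex.I_sq, hs2C, ← map_one C, ← map_sub]
    congr 1; ring
  have hPeq : (2 * C (s * Complex.I) * P + P ^ 2) * (d⁄dX ℂ P - C (2 * Complex.I) * X)
      = C (a : ℂ) * C (2 * Complex.I) * X := by
    rw [hPd]
    have h1' : d⁄dX ℂ T = (1 + (P + C (s * Complex.I)) ^ 2) * U := by rw [← hTP]; exact h1
    linear_combination (2 * C (s * Complex.I) * P + P ^ 2 + C (a : ℂ)) * h2 - C (a : ℂ) * h1'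
      - C (a : ℂ) * U * hCsq
  have hr2 : (a : ℂ) * s * r ^ 2 = 1 := by
    obtain ⟨P', hP'⟩ : X ∣ P := X_dvd_iff.mpr (by simpa using hP0)
    have hP'0 : constantCoeff P' = a * r := by
      rw [hP', show 1 = 0 + 1 from rfl, coeff_succ_X_mul] at hP1
      simpa using hP1
    have hd0 : constantCoeff (d⁄dX ℂ P) = a * r := by
      rw [← coeff_zero_eq_constantCoeff_apply, coeff_derivative]
      simpa using hP1
    have h : X * ((2 * C (s * Complex.I) * P' + P * P') * (d⁄dX ℂ P - C (2 * Complex.I) * X))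
        = X * (C (a : ℂ) * C (2 * Complex.I)) := by
      linear_combination hPeq - (2 * C (s * Complex.I) + P) *
        (d⁄dX ℂ P - C (2 * Complex.I) * X) * hP'
    have h' := congrArg constantCoeff (mul_left_cancel₀ X_ne_zero h)
    have hP00 : constantCoeff P = 0 := by simpa using hP0
    simp only [map_add, map_sub, map_mul, hP'0, hP00, hd0, constantCoeff_X, constantCoeff_C,
      map_ofNat] at h'
    have hne : 2 * Complex.I * a ≠ 0 := by simp [ha.ne']
    refine mul_left_cancel₀ hne ?_
    linear_combination h'
  refine ⟨by exact_mod_cast hr2, ?_⟩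
  set κ : ℂ := s * Complex.I / (a * r) with hκ
  have hκ2 : κ ^ 2 * a = -s ^ 3 := by
    rw [hκ, div_pow, mul_pow, Complex.I_sq]
    field_simp
    linear_combination hr2
  set e : ℂ := (s * Complex.I)⁻¹ with he
  have hse : s * Complex.I * e = 1 := mul_inv_cancel₀ (by simp [hs.ne'])
  have he2 : e ^ 2 * s ^ 2 = -1 := by
    rw [he, inv_pow, mul_pow, Complex.I_sq]
    field_simp
  set Y : ℂ⟦X⟧ := C e * rescale κ P with hY
  have hYn : ∀ n, coeff n Y = e * (κ ^ n * coeff n P) := fun n => by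
    rw [hY, coeff_C_mul, coeff_rescale]
  have hY0 : coeff 0 Y = 0 := by rw [hYn, hP0, mul_zero, mul_zero]
  have hY1 : coeff 1 Y = 1 := by
    rw [hYn, hP1, hκ, pow_one, div_mul_cancel₀ _ (mul_ne_zero haC hrC), mul_comm]
    exact hse
  have hresc := congrArg (rescale κ) hPeq
  simp only [map_mul, map_sub, map_add, map_pow, rescale_X, map_ofNat, rescale_C] at hresc
  have hc : C ((2 * (1 - a) / a : ℝ) : ℂ) = -(C e * C κ ^ 2 * C (2 * Complex.I)) := by
    rw [← map_pow, ← map_mul, ← map_mul, ← map_neg]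
    congr 1
    push_cast
    rw [div_eq_iff haC]
    linear_combination (-2 * s ^ 2 : ℂ) * hse - 2 * hs2C + 2 * Complex.I * e * hκ2
  have h2C : C e ^ 3 * C κ ^ 2 * C (a : ℂ) * C (2 * Complex.I) = 2 := by
    rw [← map_pow, ← map_pow, ← map_mul, ← map_mul, ← map_mul, ← map_ofNat C]
    congr 1
    linear_combination (2 * Complex.I * e ^ 3) * hκ2 - 2 * s * Complex.I * e * he2 + 2 * hse
  have hSe : C (s * Complex.I) * C e = 1 := by rw [← map_mul, hse, map_one]
  have hYeq : (d⁄dX ℂ Y + C ((2 * (1 - a) / a : ℝ) : ℂ) * X) * (2 * Y + Y ^ 2) = 2 * X := by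
    have hd : d⁄dX ℂ Y = C e * C κ * rescale κ (d⁄dX ℂ P) := by
      rw [hY, Derivation.leibniz, derivative_C, derivative_rescale, smul_zero, add_zero,
        smul_eq_mul, mul_assoc]
    rw [hd, hY]
    simp only [map_mul, map_ofNat] at hSe hc h2C ⊢
    linear_combination (C e ^ 3 * C κ) * hresc
      + X * (2 * C e * rescale κ P + C e ^ 2 * rescale κ P ^ 2) * hc
      - 2 * C e ^ 2 * C κ * (rescale κ (d⁄dX ℂ P) - 2 * C Complex.I * (C κ * X))
        * rescale κ P * hSe + X * h2C
  obtain ⟨Z, hZY, hZ0, hZ1, hZeq⟩ := exists_real_saddleSeries hY0 hY1 hYeq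
  refine ⟨Z, hZ0, hZ1, hZeq, fun k => ?_⟩
  have hPn : coeff (2 * k + 1) P = coeff (2 * k + 1) T := by
    rw [hP, map_sub, coeff_C, if_neg (by omega), sub_zero]
  have hcoeff := congrArg (coeff (2 * k)) h2
  rw [map_sub, coeff_derivative, coeff_C_mul, coeff_C_mul, coeff_X, if_neg (by omega), mul_zero,
    ← hPn] at hcoeff
  have hZn : ((coeff (2 * k + 1) Z : ℝ) : ℂ) = e * (κ ^ (2 * k + 1) * coeff (2 * k + 1) P) := by
    rw [← hYn, ← hZY, coeff_map]
    rfl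
  have hκr : e * κ * (a * r) = 1 := by
    rw [hκ, mul_assoc, div_mul_cancel₀ _ (mul_ne_zero haC hrC), mul_comm]
    exact hse
  have hκk : ((-a / s ^ 3 : ℝ) : ℂ) ^ k * κ ^ (2 * k) = 1 := by
    rw [pow_mul, ← mul_pow]
    push_cast
    rw [show (-a / s ^ 3 : ℂ) * κ ^ 2 = -(κ ^ 2 * a) / s ^ 3 by ring, hκ2, neg_neg,
      div_self (pow_ne_zero _ hsC), one_pow]
  rw [Complex.ofReal_mul, Complex.ofReal_mul, Complex.ofReal_mul, Complex.ofReal_pow, hZn]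
  push_cast at hcoeff hκk ⊢
  linear_combination (-coeff (2 * k) U) * hκr - r * e * κ * hcoeff
    - r * (2 * k + 1) * e * κ * coeff (2 * k + 1) P * hκk

end Bateman

namespace Bateman

open PowerSeries

/-! ### The coefficients of the expansion -/

/-- The normalising factor of the coefficients is the value `u'(0)`. -/
lemma rpow_neg_quarter_div_sqrt_eq {a r : ℝ} (ha0 : 0 < a) (ha1 : a < 1) (hr : 0 < r)
    (h : a * √(1 - a) * r ^ 2 = 1) : (1 - a) ^ (-(1 / 4) : ℝ) / √a = r := by
  have h1 : (0 : ℝ) < 1 - a := by linarith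
  have hs : 0 < √(1 - a) := Real.sqrt_pos.mpr h1
  refine (pow_left_inj₀ (by positivity) hr.le two_ne_zero).mp ?_
  rw [div_pow, Real.sq_sqrt ha0.le, ← Real.rpow_natCast, ← Real.rpow_mul h1.le,
    show (-(1 / 4) : ℝ) * ((2 : ℕ) : ℝ) = -(1 / 2) by norm_num, Real.rpow_neg h1.le,
    ← Real.sqrt_eq_rpow, div_eq_iff ha0.ne']
  field_simp
  linear_combination -h

lemma rpow_natCast_div_two {b : ℝ} (hb : 0 ≤ b) (n : ℕ) : b ^ ((n : ℝ) / 2) = √b ^ n := by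
  rw [Real.sqrt_eq_rpow, ← Real.rpow_natCast, ← Real.rpow_mul hb]
  congr 1; ring

/-- The even Taylor coefficients of `du/dw` are real up to the normalisation, and the first five are
the stated rational functions of `a` and `√(1 - a)`. -/
lemma exists_coefficients {a : ℝ} (ha0 : 0 < a) (ha1 : a < 1) {u : ℂ → ℂ}
    (hu : IsSaddleInversion a u) :
    ∃ A : ℕ → ℝ,
      (∀ k : ℕ, derivTaylorCoeff u (2 * k) =
        (((1 - a) ^ (-(1 / 4) : ℝ) / Real.sqrt a * A k : ℝ) : ℂ)) ∧
      A 0 = 1 ∧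
      A 1 = -(8 - 12 * a + 9 * a ^ 2) / (24 * a * (1 - a) ^ (3 / 2 : ℝ)) ∧
      A 2 = (64 - 192 * a + 288 * a ^ 2 + 360 * a ^ 3 - 135 * a ^ 4) /
        (3456 * a ^ 2 * (1 - a) ^ 3) ∧
      A 3 = (71168 - 320256 * a + 554688 * a ^ 2 - 518400 * a ^ 3 - 340200 * a ^ 4
          + 170100 * a ^ 5 - 42525 * a ^ 6) /
        (6220800 * a ^ 3 * (1 - a) ^ (9 / 2 : ℝ)) ∧
      A 4 = (-2338816 + 14032896 * a - 36790272 * a ^ 2 + 55710720 * a ^ 3 - 32876928 * a ^ 4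
          + 231880320 * a ^ 5 - 68584320 * a ^ 6 + 30618000 * a ^ 7 - 5740875 * a ^ 8) /
        (4180377600 * a ^ 4 * (1 - a) ^ 6) := by
  obtain ⟨r, hr, hr'⟩ := hu.deriv_pos
  have hs := (sqrt_mem_Ioo ha0 ha1).1
  have hs2 : √(1 - a) ^ 2 = 1 - a := Real.sq_sqrt (by linarith)
  have hcos : Complex.cos (u 0) ≠ 0 := by
    rw [hu.map_zero]
    exact cos_batemanSaddle_ne_zero ha0 ha1
  set V : ℂ → ℂ := fun w => Complex.tan (u w) with hV
  have hVa : AnalyticAt ℂ V 0 := (analyticAt_tan hcos).comp hu.analyticAt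
  have hVd : ∀ᶠ w in 𝓝 (0 : ℂ), HasDerivAt V ((1 + V w * V w) * deriv u w) w := by
    have h : ∀ᶠ w in 𝓝 (0 : ℂ), Complex.cos (u w) ≠ 0 :=
      (Complex.continuous_cos.continuousAt.comp hu.analyticAt.continuousAt).eventually_ne hcos
    filter_upwards [h, hu.analyticAt.eventually_analyticAt] with w h1 h2
    rw [← pow_two]
    exact (hasDerivAt_tan' h1).comp w h2.differentiableAt.hasDerivAt
  have hODE1 : deriv V =ᶠ[𝓝 0] fun w => (1 + V w * V w) * deriv u w :=
    hVd.mono fun w hw => hw.deriv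
  have hODE2 : deriv V =ᶠ[𝓝 0] fun w => a * deriv u w + 2 * Complex.I * w := by
    filter_upwards [hVd, hu.phase_eq.eventually_nhds, hu.analyticAt.eventually_analyticAt]
      with w h1 h2 h3
    have h4 : HasDerivAt (fun w => batemanPhase a (u w) - batemanPhase a (batemanSaddle a))
        (Complex.I * ((1 + V w * V w) * deriv u w - a * deriv u w)) w :=
      ((h1.sub (h3.differentiableAt.hasDerivAt.const_mul (a : ℂ))).const_mul Complex.I).sub_const _
    have h5 : HasDerivAt (fun w : ℂ => -w ^ 2) (-(2 * w)) w := by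
      simpa using (hasDerivAt_pow 2 w).fun_neg
    have h6 := (h4.congr_of_eventuallyEq (EventuallyEq.symm h2)).unique h5
    rw [h1.deriv]
    linear_combination (-Complex.I) * h6 + ((1 + V w * V w) * deriv u w - a * deriv u w) *
      Complex.I_sq
  have hT0 : coeff 0 (taylorSeries V) = (√(1 - a) : ℝ) * Complex.I := by
    simp [taylorSeries, hV, hu.map_zero, tan_batemanSaddle ha0 ha1]
  have hU0 : coeff 0 (taylorSeries (deriv u)) = r := by simp [taylorSeries, hr']
  have hda := hu.analyticAt.deriv
  have h1 : d⁄dX ℂ (taylorSeries V) = (1 + taylorSeries V ^ 2) * taylorSeries (deriv u) := by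
    rw [derivative_taylorSeries, taylorSeries_congr hODE1, taylorSeries_mul (by fun_prop) hda,
      taylorSeries_add analyticAt_const (by fun_prop), taylorSeries_mul hVa hVa,
      taylorSeries_const, map_one, pow_two]
  have h2 : d⁄dX ℂ (taylorSeries V) - C (a : ℂ) * taylorSeries (deriv u)
      = C (2 * Complex.I) * X := by
    rw [derivative_taylorSeries, taylorSeries_congr hODE2,
      taylorSeries_add (by fun_prop) (by fun_prop), taylorSeries_mul analyticAt_const hda,
      taylorSeries_mul analyticAt_const (by fun_prop), taylorSeries_const, taylorSeries_const,
      taylorSeries_id, add_sub_cancel_left]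
  obtain ⟨hr2, Z, hZ0, hZ1, hZeq, hU⟩ := exists_saddleSeries ha0 hs hs2 hr hT0 hU0 h1 h2
  obtain ⟨c3, c5, c7, c9⟩ := saddleSeries_coeff hZ0 hZ1 hZeq
  have h32 : (1 - a) ^ (3 / 2 : ℝ) = √(1 - a) ^ 3 := by
    exact_mod_cast rpow_natCast_div_two (by linarith) 3
  have h92 : (1 - a) ^ (9 / 2 : ℝ) = √(1 - a) ^ 9 := by
    exact_mod_cast rpow_natCast_div_two (by linarith) 9
  have h3 : (1 - a) ^ 3 = √(1 - a) ^ 6 := by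
    rw [show √(1 - a) ^ 6 = (√(1 - a) ^ 2) ^ 3 by ring, hs2]
  have h6 : (1 - a) ^ 6 = √(1 - a) ^ 12 := by
    rw [show √(1 - a) ^ 12 = (√(1 - a) ^ 2) ^ 6 by ring, hs2]
  refine ⟨fun k => (2 * k + 1) * coeff (2 * k + 1) Z * (-a / √(1 - a) ^ 3) ^ k, fun k => ?_, ?_,
    ?_, ?_, ?_, ?_⟩
  · rw [rpow_neg_quarter_div_sqrt_eq ha0 ha1 hr hr2, ← hU]
    simp [taylorSeries, derivTaylorCoeff]
  · simp [hZ1]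
  · rw [h32]
    simp only [Nat.cast_one, mul_one, Nat.reduceAdd, c3]
    field_simp
    ring
  · rw [h3]
    simp only [Nat.reduceMul, Nat.reduceAdd, c5]
    field_simp
    push_cast
    ring
  · rw [h92]
    simp only [Nat.reduceMul, Nat.reduceAdd, c7]
    field_simp
    push_cast
    ring
  · rw [h6]
    simp only [Nat.reduceMul, Nat.reduceAdd, c9]
    field_simp
    push_cast
    ring

end Bateman

namespace Bateman

open MeasureTheory Complex

/-! ### The contribution of the saddle point -/

lemma exists_norm_sub_taylor_le {g : ℂ → ℂ} (hg : AnalyticAt ℂ g 0) (M : ℕ) :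
    ∃ C : ℝ, ∀ᶠ w in 𝓝 (0 : ℂ),
      ‖g w - ∑ n ∈ Finset.range M, iteratedDeriv n g 0 / (n.factorial : ℂ) * w ^ n‖
        ≤ C * ‖w‖ ^ M := by
  obtain ⟨C, hC⟩ := (hg.hasFPowerSeriesAt.isBigO_sub_partialSum_pow M).bound
  refine ⟨C, hC.mono fun w hw => ?_⟩
  simpa [FormalMultilinearSeries.partialSum, mul_comm] using hw

/-- The inverse of `tan ∘ u` near the saddle point `i √(1 - a)` of the `v`-plane: a holomorphic
function `W` with `u (W v) = arctan v`. -/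
lemma exists_saddleCoordinate {a : ℝ} (ha0 : 0 < a) (ha1 : a < 1) {u : ℂ → ℂ}
    (hu : IsSaddleInversion a u) :
    ∃ W : ℂ → ℂ, AnalyticAt ℂ W ((√(1 - a) : ℝ) * I) ∧ W ((√(1 - a) : ℝ) * I) = 0 ∧
      (∀ᶠ v in 𝓝 (((√(1 - a) : ℝ) : ℂ) * I), u (W v) = arctan v) ∧
      ∃ m : ℝ, 0 < m ∧ HasDerivAt W m ((√(1 - a) : ℝ) * I) := by
  obtain ⟨r, hr, hr'⟩ := hu.deriv_pos
  set v₀ : ℂ := (√(1 - a) : ℝ) * I with hv₀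
  have him : |v₀.im| < 1 := by
    have := sqrt_mem_Ioo ha0 ha1
    simpa [hv₀, abs_of_pos this.1] using this.2
  have harc : arctan v₀ = u 0 := by
    have hre : (batemanSaddle a).re = 0 := by simp [batemanSaddle]
    rw [hv₀, ← tan_batemanSaddle ha0 ha1, hu.map_zero]
    refine arctan_tan ?_ ?_ ?_
    · intro h
      have := congrArg re h
      rw [hre] at this
      norm_num at this
      linarith [Real.pi_pos]
    · rw [hre]; linarith [Real.pi_pos]
    · rw [hre]; positivity
  have hd0 : deriv u 0 ≠ 0 := by rw [hr']; exact ofReal_ne_zero.mpr hr.ne'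
  set ω := hu.analyticAt.hasStrictDerivAt.localInverse u _ 0 hd0 with hω
  have hωa : AnalyticAt ℂ ω (arctan v₀) := by
    rw [harc]
    exact hu.analyticAt.analyticAt_localInverse hd0
  have harca : AnalyticAt ℂ arctan v₀ := by
    have hopen : IsOpen {v : ℂ | |v.im| < 1} :=
      isOpen_lt (continuous_abs.comp continuous_im) continuous_const
    exact DifferentiableOn.analyticAt (s := {v : ℂ | |v.im| < 1})
      (fun v hv => (hasDerivAt_arctan hv).differentiableAt.differentiableWithinAt)
      (hopen.mem_nhds him)
  have hinv : ∀ᶠ z in 𝓝 (arctan v₀), u (ω z) = z := by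
    rw [harc]
    exact hu.analyticAt.hasStrictDerivAt.eventually_right_inverse hd0
  refine ⟨fun v => ω (arctan v), hωa.comp harca, ?_, harca.continuousAt.eventually hinv,
    (r * a)⁻¹, by positivity, ?_⟩
  · show ω (arctan v₀) = 0
    rw [harc]
    exact HasStrictFDerivAt.localInverse_apply_image ..
  · have h1 : HasDerivAt ω (r : ℂ)⁻¹ (arctan v₀) := by
      rw [harc, ← hr']
      exact (hu.analyticAt.hasStrictDerivAt.to_localInverse hd0).hasDerivAt
    refine (h1.comp v₀ (hasDerivAt_arctan him)).congr_deriv ?_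
    rw [hv₀, mul_pow, sq_sqrt_one_sub ha1, I_sq]
    push_cast
    rw [mul_inv, one_div]
    congr 2
    ring

/-- A short segment of the line `im v = √(1 - a)` around the saddle point contributes the partial
sums of the expansion, with an explicit bound for the error. -/
lemma exists_local_norm_sub_le {a : ℝ} (ha0 : 0 < a) (ha1 : a < 1) {u : ℂ → ℂ}
    (hu : IsSaddleInversion a u) (N : ℕ) :
    ∃ ε D B η : ℝ, 0 < ε ∧ 0 < η ∧ ∀ x : ℝ, 0 < x →
      ‖(∫ y in (-ε)..ε, batemanIntegrand a x (y + (√(1 - a) : ℝ) * I))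
        - Real.exp (-x * batemanPsi a) * ∑ k ∈ Finset.range N, derivTaylorCoeff u (2 * k)
          * ((Real.Gamma (k + 1 / 2) / (x ^ k * Real.sqrt x) : ℝ) : ℂ)‖
      ≤ Real.exp (-x * batemanPsi a) * (D / (x ^ N * Real.sqrt x) + B * Real.exp (-x * η)) := by
  obtain ⟨W, hWa, hW0, huW, m, hm, hWd⟩ := exists_saddleCoordinate ha0 ha1 hu
  have hs := sqrt_mem_Ioo ha0 ha1
  set s : ℝ := √(1 - a) with hsdef
  set v₀ : ℂ := (s : ℂ) * I with hv₀
  obtain ⟨C, hC⟩ := exists_norm_sub_taylor_le hu.analyticAt.deriv (2 * N)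
  set B : ℝ := ‖deriv u 0‖ + 1 with hB
  -- a disc in the `w`-plane on which `u` is a holomorphic inversion with bounded derivative
  have hdisc : ∀ᶠ w in 𝓝 (0 : ℂ), AnalyticAt ℂ u w ∧
      batemanPhase a (u w) - batemanPhase a (batemanSaddle a) = -w ^ 2 ∧ ‖deriv u w‖ ≤ B ∧
      ‖deriv u w - ∑ n ∈ Finset.range (2 * N), derivTaylorCoeff u n * w ^ n‖
        ≤ C * ‖w‖ ^ (2 * N) := by
    have hb : ∀ᶠ w in 𝓝 (0 : ℂ), ‖deriv u w‖ < B :=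
      hu.analyticAt.deriv.continuousAt.norm.eventually_lt continuousAt_const (lt_add_one _)
    filter_upwards [hu.analyticAt.eventually_analyticAt, hu.phase_eq, hb, hC] with w h1 h2 h3 h4
    exact ⟨h1, h2, h3.le, h4⟩
  obtain ⟨ρ, hρ, hρ'⟩ := Metric.eventually_nhds_iff_ball.mp hdisc
  -- a disc in the `v`-plane on which `W` is holomorphic and takes values in the first disc
  have hdisc' : ∀ᶠ v in 𝓝 v₀, AnalyticAt ℂ W v ∧ u (W v) = arctan v ∧ |v.im| < 1 ∧
      W v ∈ Metric.ball (0 : ℂ) ρ ∧ ‖W v - m * (v - v₀)‖ ≤ m / 4 * ‖v - v₀‖ := by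
    have him : ∀ᶠ v in 𝓝 v₀, |v.im| < 1 := by
      refine (isOpen_lt (continuous_abs.comp continuous_im) continuous_const).mem_nhds ?_
      simpa [hv₀, abs_of_pos hs.1] using hs.2
    have hball : ∀ᶠ v in 𝓝 v₀, W v ∈ Metric.ball (0 : ℂ) ρ :=
      hWa.continuousAt.eventually (by rw [hW0]; exact Metric.ball_mem_nhds _ hρ)
    have hlin := (hasDerivAt_iff_isLittleO.mp hWd).def (c := m / 4) (by positivity)
    filter_upwards [hWa.eventually_analyticAt, huW, him, hball, hlin] with v h1 h2 h3 h4 h5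
    refine ⟨h1, h2, h3, h4, ?_⟩
    rw [hW0, sub_zero, smul_eq_mul, mul_comm] at h5
    exact h5
  obtain ⟨ε₀, hε₀, hε₀'⟩ := Metric.eventually_nhds_iff_ball.mp hdisc'
  -- `m ε` is, to first order, the value of `|w|` at the end points `v₀ ± ε`
  set ε : ℝ := min (ε₀ / 2) (ρ / (2 * m)) with hε
  have hεpos : 0 < ε := lt_min (by positivity) (by positivity)
  have hε1 : ε < ε₀ := (min_le_left _ _).trans_lt (by linarith)
  set δ : ℝ := m * ε with hδ
  have hδpos : 0 < δ := mul_pos hm hεpos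
  have hδρ : δ ≤ ρ / 2 := by
    have := mul_le_mul_of_nonneg_left (min_le_right (ε₀ / 2) (ρ / (2 * m))) hm.le
    rw [hδ, hε]
    refine this.trans (le_of_eq ?_)
    field_simp
  have hline : ∀ y : ℝ, |y| ≤ ε → (y : ℂ) + v₀ ∈ Metric.ball v₀ ε₀ := fun y hy => by
    rw [mem_ball_iff_norm, add_sub_cancel_right, norm_real, Real.norm_eq_abs]
    linarith
  have hreal : ∀ w : ℝ, |w| ≤ δ → (w : ℂ) ∈ Metric.ball (0 : ℂ) ρ := fun w hw => by
    rw [mem_ball_zero_iff, norm_real, Real.norm_eq_abs]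
    linarith
  obtain ⟨D, hD⟩ := exists_norm_intervalIntegral_exp_mul_sub_le (g := fun w : ℝ => deriv u w) hδpos
    (fun w hw => by
      have hw' : |w| ≤ δ := abs_le.mpr ⟨hw.1.le, hw.2⟩
      exact ((hρ' w (hreal w hw')).1.deriv.continuousAt.comp
        continuous_ofReal.continuousAt).continuousWithinAt)
    (derivTaylorCoeff u) N (C := C) (fun w hw => by
      have hw' : |w| ≤ δ := abs_le.mpr ⟨hw.1.le, hw.2⟩
      simpa using (hρ' w (hreal w hw')).2.2.2)
  refine ⟨ε, D, B * (δ / 4) + B * (δ / 4), δ ^ 2 / 2, hεpos, by positivity, fun x hx => ?_⟩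
  -- a primitive of the Gaussian integrand in the `w`-plane
  set f : ℂ → ℂ := fun w => exp (-x * w ^ 2) * deriv u w with hf
  obtain ⟨K, hK⟩ : IsExactOn f (Metric.ball 0 ρ) := by
    refine DifferentiableOn.isExactOn_ball fun w hw => ?_
    have := (hρ' w hw).1.deriv.differentiableAt
    refine DifferentiableAt.differentiableWithinAt ?_
    rw [hf]
    fun_prop
  have hint : ∫ y in (-ε)..ε, batemanIntegrand a x (y + v₀)
      = Real.exp (-x * batemanPsi a) * (K (W (ε + v₀)) - K (W ((-ε : ℝ) + v₀))) := by
    have hderiv : ∀ y ∈ Set.uIcc (-ε) ε, HasDerivAt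
        (fun y : ℝ => (Real.exp (-x * batemanPsi a) : ℂ) * K (W (y + v₀)))
        (batemanIntegrand a x (y + v₀)) y := fun y hy => by
      rw [Set.uIcc_of_le (by linarith)] at hy
      have hv := hline y (abs_le.mpr ⟨hy.1, hy.2⟩)
      obtain ⟨h1, h2, h3, h4, -⟩ := hε₀' _ hv
      set v : ℂ := y + v₀ with hvdef
      obtain ⟨g1, g2, -, -⟩ := hρ' _ h4
      have hcomp : HasDerivAt (fun v => u (W v)) (deriv u (W v) * deriv W v) v :=
        g1.differentiableAt.hasDerivAt.comp v h1.differentiableAt.hasDerivAt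
      have heq : (fun v => u (W v)) =ᶠ[𝓝 v] arctan :=
        Filter.eventually_of_mem (Metric.isOpen_ball.mem_nhds hv) fun v hv => (hε₀' v hv).2.1
      have hprod := hcomp.unique ((hasDerivAt_arctan h3).congr_of_eventuallyEq heq)
      have hvI : v ≠ I := fun h => by rw [h] at h3; simp at h3
      have hvI' : v ≠ -I := fun h => by rw [h] at h3; simp at h3
      rw [batemanPhase_saddle ha0 ha1, h2, batemanPhase, tan_arctan hvI hvI'] at g2
      have hchain : HasDerivAt (fun y : ℝ => (Real.exp (-x * batemanPsi a) : ℂ) * K (W (y + v₀)))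
          (Real.exp (-x * batemanPsi a) * (f (W v) * deriv W v)) y := by
        have hKW : HasDerivAt (fun v => K (W v)) (f (W v) * deriv W v) v :=
          (hK _ h4).comp v h1.differentiableAt.hasDerivAt
        have hshift : HasDerivAt (fun z : ℂ => K (W (z + v₀))) (f (W v) * deriv W v) (y : ℂ) :=
          HasDerivAt.comp_add_const (y : ℂ) v₀ hKW
        exact (hshift.comp_ofReal).const_mul _
      refine hchain.congr_deriv ?_
      have hexp : exp (x * (I * (v - a * arctan v)))
          = Real.exp (-x * batemanPsi a) * exp (-x * W v ^ 2) := by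
        rw [ofReal_exp, ← Complex.exp_add]
        congr 1
        push_cast at g2 ⊢
        linear_combination (x : ℂ) * g2
      rw [batemanIntegrand, hexp, div_eq_mul_one_div, ← hprod, hf]
      ring
    rw [intervalIntegral.integral_eq_sub_of_hasDerivAt hderiv, mul_sub]
    refine ContinuousOn.intervalIntegrable fun y hy => ?_
    rw [Set.uIcc_of_le (by linarith)] at hy
    have hv := hline y (abs_le.mpr ⟨hy.1, hy.2⟩)
    refine ContinuousAt.continuousWithinAt ?_
    exact ContinuousAt.comp (f := fun y : ℝ => (y : ℂ) + v₀)
      (differentiableAt_batemanIntegrand a x (hε₀' _ hv).2.2.1).continuousAt (by fun_prop)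
  have hgauss : ∫ w in (-δ)..δ, deriv u w * Real.exp (-x * w ^ 2) = K δ - K (-δ : ℝ) := by
    have hderiv : ∀ w ∈ Set.uIcc (-δ) δ, HasDerivAt (fun w : ℝ => K w)
        (deriv u w * Real.exp (-x * w ^ 2)) w := fun w hw => by
      rw [Set.uIcc_of_le (by linarith)] at hw
      refine ((hK w (hreal w (abs_le.mpr hw))).comp_ofReal).congr_deriv ?_
      rw [hf, mul_comm]
      push_cast
      rfl
    refine intervalIntegral.integral_eq_sub_of_hasDerivAt hderiv
      (ContinuousOn.intervalIntegrable fun w hw => ?_)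
    rw [Set.uIcc_of_le (by linarith)] at hw
    have h1 := (hρ' w (hreal w (abs_le.mpr hw))).1.deriv.continuousAt.comp
      (continuous_ofReal.continuousAt (x := w))
    refine ContinuousAt.continuousWithinAt (h1.mul ?_)
    fun_prop
  -- moving an end point of the path within the sector where `re w² ≥ δ² / 2` is harmless
  have hend : ∀ σ y : ℝ, |σ| = 1 → y = σ * ε →
      ‖K (W (y + v₀)) - K ((σ * δ : ℝ) : ℂ)‖ ≤ B * (δ / 4) * Real.exp (-x * (δ ^ 2 / 2)) := by
    intro σ y hσ hy
    have hσ2 : σ ^ 2 = 1 := by rw [← sq_abs, hσ, one_pow]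
    have hyabs : |y| = ε := by rw [hy, abs_mul, hσ, one_mul, abs_of_pos hεpos]
    have hsub : Metric.closedBall ((σ * δ : ℝ) : ℂ) (δ / 4) ⊆ Metric.ball 0 ρ := fun w hw => by
      rw [mem_closedBall_iff_norm] at hw
      rw [mem_ball_zero_iff]
      have := norm_sub_norm_le w ((σ * δ : ℝ) : ℂ)
      rw [norm_real, Real.norm_eq_abs, abs_mul, hσ, one_mul, abs_of_pos hδpos] at this
      linarith
    have hmem : W (y + v₀) ∈ Metric.closedBall ((σ * δ : ℝ) : ℂ) (δ / 4) := by
      have h := (hε₀' _ (hline y hyabs.le)).2.2.2.2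
      rw [add_sub_cancel_right, norm_real, Real.norm_eq_abs, hyabs] at h
      rw [mem_closedBall_iff_norm]
      have e1 : ((σ * δ : ℝ) : ℂ) = m * (y : ℂ) := by rw [hδ, hy]; push_cast; ring
      rw [e1]
      refine h.trans (le_of_eq ?_)
      rw [hδ]; ring
    have hcenter : ((σ * δ : ℝ) : ℂ) ∈ Metric.closedBall ((σ * δ : ℝ) : ℂ) (δ / 4) :=
      Metric.mem_closedBall_self (by positivity)
    have hbound : ∀ w ∈ Metric.closedBall ((σ * δ : ℝ) : ℂ) (δ / 4),
        ‖f w‖ ≤ Real.exp (-x * (δ ^ 2 / 2)) * B := fun w hw => by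
      rw [hf]
      simp only
      rw [norm_mul, norm_exp]
      refine mul_le_mul (Real.exp_le_exp.mpr ?_) (hρ' w (hsub hw)).2.2.1 (norm_nonneg _)
        (Real.exp_pos _).le
      rw [mem_closedBall_iff_norm] at hw
      have h1 := (abs_re_le_norm _).trans hw
      have h2 := (abs_im_le_norm _).trans hw
      rw [sub_re, ofReal_re] at h1
      rw [sub_im, ofReal_im, sub_zero] at h2
      have hre : (-(x : ℂ) * w ^ 2).re = -x * (w.re ^ 2 - w.im ^ 2) := by
        rw [← ofReal_neg, re_ofReal_mul, pow_two, mul_re]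
        ring
      rw [hre]
      have h3 : w.im ^ 2 ≤ (δ / 4) ^ 2 := sq_le_sq' (abs_le.mp h2).1 (abs_le.mp h2).2
      have h4 : 3 / 4 * δ ≤ σ * w.re := by
        have : |σ * w.re - δ| ≤ δ / 4 := by
          have e : σ * w.re - δ = σ * (w.re - σ * δ) := by linear_combination δ * hσ2
          rw [e, abs_mul, hσ, one_mul]
          exact h1
        linarith [(abs_le.mp this).1]
      have h5 : (3 / 4 * δ) ^ 2 ≤ w.re ^ 2 := by
        have := pow_le_pow_left₀ (by positivity) h4 2
        rwa [mul_pow σ, hσ2, one_mul] at this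
      nlinarith
    have := Convex.norm_image_sub_le_of_norm_hasDerivWithin_le
      (fun w hw => (hK w (hsub hw)).hasDerivWithinAt) hbound (convex_closedBall _ _) hcenter hmem
    refine this.trans ?_
    rw [mem_closedBall_iff_norm] at hmem
    have hB0 : 0 ≤ B := by positivity
    calc Real.exp (-x * (δ ^ 2 / 2)) * B * ‖W (y + v₀) - ((σ * δ : ℝ) : ℂ)‖
        ≤ Real.exp (-x * (δ ^ 2 / 2)) * B * (δ / 4) := by gcongr
      _ = _ := by ring
  have hplus := hend 1 ε (by simp) (by ring)
  have hminus := hend (-1) (-ε) (by simp) (by ring)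
  rw [one_mul] at hplus
  rw [neg_one_mul] at hminus
  have hwatson := hD x hx
  rw [hgauss] at hwatson
  rw [hint, ← mul_sub, norm_mul, norm_real, Real.norm_of_nonneg (Real.exp_pos _).le]
  refine mul_le_mul_of_nonneg_left ?_ (Real.exp_pos _).le
  set S := ∑ k ∈ Finset.range N, derivTaylorCoeff u (2 * k)
          * ((Real.Gamma (k + 1 / 2) / (x ^ k * Real.sqrt x) : ℝ) : ℂ)
  have hsplit : K (W (ε + v₀)) - K (W ((-ε : ℝ) + v₀)) - S
      = (K δ - K (-δ : ℝ) - S) + (K (W (ε + v₀)) - K δ)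
        - (K (W ((-ε : ℝ) + v₀)) - K (-δ : ℝ)) := by ring
  rw [hsplit]
  refine (norm_sub_le _ _).trans ((add_le_add_left (norm_add_le _ _) _).trans ?_)
  linarith

end Bateman

namespace Bateman

open MeasureTheory Complex

/-! ### Assembling the expansion -/

lemma eventually_exp_neg_mul_le {η : ℝ} (hη : 0 < η) (N : ℕ) :
    ∀ᶠ x : ℝ in atTop, Real.exp (-x * η) ≤ 1 / (x ^ N * √x) := by
  have h := (isLittleO_pow_exp_pos_mul_atTop (N + 1) hη).def one_pos
  filter_upwards [h, eventually_ge_atTop 1] with x hx h1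
  have h0 : 0 < x := by linarith
  rw [Real.norm_of_nonneg (by positivity), Real.norm_of_nonneg (by positivity), one_mul] at hx
  rw [neg_mul, Real.exp_neg, ← one_div, mul_comm x]
  refine one_div_le_one_div_of_le (by positivity) (le_trans ?_ hx)
  rw [pow_succ]
  have : √x ≤ x := Real.sqrt_le_iff.mpr ⟨h0.le, by nlinarith⟩
  gcongr

lemma exists_eventually_norm_integral_sub_le {a : ℝ} (ha0 : 0 < a) (ha1 : a < 1) {u : ℂ → ℂ}
    (hu : IsSaddleInversion a u) (N : ℕ) :
    ∃ M : ℝ, ∀ᶠ x : ℝ in atTop,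
      ‖(∫ y : ℝ, batemanIntegrand a x y)
        - Real.exp (-x * batemanPsi a) * ∑ k ∈ Finset.range N, derivTaylorCoeff u (2 * k)
          * ((Real.Gamma (k + 1 / 2) / (x ^ k * √x) : ℝ) : ℂ)‖
      ≤ Real.exp (-x * batemanPsi a) * (M / (x ^ N * √x)) := by
  have hs := sqrt_mem_Ioo ha0 ha1
  obtain ⟨ε, D, B, η, hε, hη, hloc⟩ := exists_local_norm_sub_le ha0 ha1 hu N
  obtain ⟨C, η', hη', htail⟩ := exists_norm_integral_compl_le ha0 hs.1 hs.2 hε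
  refine ⟨D + |B| + |C|, ?_⟩
  filter_upwards [eventually_exp_neg_mul_le hη N, eventually_exp_neg_mul_le hη' N,
    eventually_gt_atTop 0] with x h1 h2 hx
  have hi := integrable_batemanIntegrand a x ha0.le hx.le hs.1.le hs.2
  rw [integral_batemanIntegrand_eq ha0.le hx.le hs.1.le hs.2,
    ← integral_add_compl measurableSet_Ioc hi (s := Set.Ioc (-ε) ε),
    ← intervalIntegral.integral_of_le (by linarith), add_sub_right_comm]
  refine (norm_add_le _ _).trans ((add_le_add (hloc x hx) (htail x hx.le)).trans ?_)
  have hsplit : Real.exp (-x * (√(1 - a) - a * Real.artanh √(1 - a) + η'))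
      = Real.exp (-x * batemanPsi a) * Real.exp (-x * η') := by
    rw [← Real.exp_add, batemanPsi]
    congr 1; ring
  rw [hsplit]
  have e1 : B * Real.exp (-x * η) ≤ |B| * (1 / (x ^ N * √x)) :=
    mul_le_mul (le_abs_self B) h1 (Real.exp_pos _).le (abs_nonneg B)
  have e2 : C * Real.exp (-x * η') ≤ |C| * (1 / (x ^ N * √x)) :=
    mul_le_mul (le_abs_self C) h2 (Real.exp_pos _).le (abs_nonneg C)
  have e3 : (D + |B| + |C|) / (x ^ N * √x)
      = D / (x ^ N * √x) + |B| * (1 / (x ^ N * √x)) + |C| * (1 / (x ^ N * √x)) := by ring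
  calc Real.exp (-x * batemanPsi a) * (D / (x ^ N * √x) + B * Real.exp (-x * η))
        + C * (Real.exp (-x * batemanPsi a) * Real.exp (-x * η'))
      = Real.exp (-x * batemanPsi a) *
          (D / (x ^ N * √x) + B * Real.exp (-x * η) + C * Real.exp (-x * η')) := by ring
    _ ≤ _ := by
      rw [e3]
      gcongr

lemma hasAsymptoticSeries_batemanK {a : ℝ} (ha0 : 0 < a) (ha1 : a < 1) {u : ℂ → ℂ}
    (hu : IsSaddleInversion a u) {A : ℕ → ℝ}
    (hA : ∀ k : ℕ, derivTaylorCoeff u (2 * k) =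
      (((1 - a) ^ (-(1 / 4) : ℝ) / Real.sqrt a * A k : ℝ) : ℂ)) :
    HasAsymptoticSeries (fun x => batemanK (a * x) x) (batemanPrefactor a)
      (fun k => Real.Gamma (k + 1 / 2) / Real.Gamma (1 / 2) * A k) := by
  intro N
  obtain ⟨M, hM⟩ := exists_eventually_norm_integral_sub_le ha0 ha1 hu N
  set b : ℝ := (1 - a) ^ (-(1 / 4) : ℝ) with hb
  have hbpos : 0 < b := Real.rpow_pos_of_pos (by linarith) _
  have hpi := Real.pi_pos
  refine IsBigO.of_bound (M / √Real.pi * (√a / b)) ?_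
  filter_upwards [hM, eventually_gt_atTop 0] with x hx h0
  have hsqrt : √(Real.pi * a * x) = √Real.pi * √a * √x := by
    rw [Real.sqrt_mul (by positivity), Real.sqrt_mul hpi.le]
  have hpi0 : 0 < √Real.pi := Real.sqrt_pos.mpr hpi
  have ha0' : 0 < √a := Real.sqrt_pos.mpr ha0
  have hx0' : 0 < √x := Real.sqrt_pos.mpr h0
  have hsum : (Real.exp (-x * batemanPsi a) : ℂ) * ∑ k ∈ Finset.range N,
        derivTaylorCoeff u (2 * k) * ((Real.Gamma (k + 1 / 2) / (x ^ k * √x) : ℝ) : ℂ)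
      = ((Real.pi * (batemanPrefactor a x * ∑ k ∈ Finset.range N,
          Real.Gamma (k + 1 / 2) / Real.Gamma (1 / 2) * A k / x ^ k) : ℝ) : ℂ) := by
    simp_rw [hA]
    norm_cast
    rw [Finset.mul_sum, Finset.mul_sum, Finset.mul_sum]
    refine Finset.sum_congr rfl fun k _ => ?_
    rw [batemanPrefactor, hsqrt, Real.Gamma_one_half_eq, ← hb]
    field_simp
    rw [Real.sq_sqrt hpi.le]
  rw [hsum] at hx
  have hre := (abs_re_le_norm _).trans hx
  rw [sub_re, ofReal_re] at hre
  rw [batemanK_eq a x ha0.le h0.le, Real.norm_eq_abs]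
  set R := (∫ y : ℝ, batemanIntegrand a x y).re
  set P := batemanPrefactor a x * ∑ k ∈ Finset.range N,
          Real.Gamma (k + 1 / 2) / Real.Gamma (1 / 2) * A k / x ^ k with hP
  have hPpos : 0 < batemanPrefactor a x / x ^ N := by
    rw [batemanPrefactor]
    positivity
  rw [Real.norm_of_nonneg hPpos.le, show 1 / Real.pi * R - P = 1 / Real.pi * (R - Real.pi * P) by
    field_simp, abs_mul, abs_of_pos (by positivity)]
  refine (mul_le_mul_of_nonneg_left hre (by positivity)).trans (le_of_eq ?_)
  rw [batemanPrefactor, hsqrt, ← hb]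
  field_simp
  rw [Real.sq_sqrt hpi.le]
  exact mul_comm _ _

end Bateman

/-- In the second half, `A k` is the coefficient written `Â_{2k}(a)`. -/
theorem theorem2 (a : ℝ) (ha0 : 0 < a) (ha1 : a < 1) :
    HasDerivAt (batemanPhase a) 0 (batemanSaddle a) ∧
    HasDerivAt (batemanPhase a) 0 (-batemanSaddle a) ∧
    batemanPhase a (batemanSaddle a) = ((-batemanPsi a : ℝ) : ℂ) ∧
    0 < batemanPsi a ∧
    (∃ u : ℂ → ℂ, IsSaddleInversion a u) ∧
    ∀ u : ℂ → ℂ, IsSaddleInversion a u →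
      ∃ A : ℕ → ℝ,
        (∀ k : ℕ, derivTaylorCoeff u (2 * k) =
          (((1 - a) ^ (-(1 / 4) : ℝ) / Real.sqrt a * A k : ℝ) : ℂ)) ∧
        A 0 = 1 ∧
        A 1 = -(8 - 12 * a + 9 * a ^ 2) / (24 * a * (1 - a) ^ (3 / 2 : ℝ)) ∧
        A 2 = (64 - 192 * a + 288 * a ^ 2 + 360 * a ^ 3 - 135 * a ^ 4) /
          (3456 * a ^ 2 * (1 - a) ^ 3) ∧
        A 3 = (71168 - 320256 * a + 554688 * a ^ 2 - 518400 * a ^ 3 - 340200 * a ^ 4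
            + 170100 * a ^ 5 - 42525 * a ^ 6) /
          (6220800 * a ^ 3 * (1 - a) ^ (9 / 2 : ℝ)) ∧
        A 4 = (-2338816 + 14032896 * a - 36790272 * a ^ 2 + 55710720 * a ^ 3 - 32876928 * a ^ 4
            + 231880320 * a ^ 5 - 68584320 * a ^ 6 + 30618000 * a ^ 7 - 5740875 * a ^ 8) /
          (4180377600 * a ^ 4 * (1 - a) ^ 6) ∧
        HasAsymptoticSeries (fun x => batemanK (a * x) x) (batemanPrefactor a)
          (fun k => Real.Gamma (k + 1 / 2) / Real.Gamma (1 / 2) * A k) := by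
  refine ⟨Bateman.hasDerivAt_batemanPhase_saddle ha0 ha1,
    Bateman.hasDerivAt_batemanPhase_neg_saddle ha0 ha1, Bateman.batemanPhase_saddle ha0 ha1,
    Bateman.batemanPsi_pos ha0 ha1, Bateman.exists_isSaddleInversion ha0 ha1, fun u hu => ?_⟩
  obtain ⟨A, hA, h0, h1, h2, h3, h4⟩ := Bateman.exists_coefficients ha0 ha1 hu
  exact ⟨A, hA, h0, h1, h2, h3, h4, Bateman.hasAsymptoticSeries_batemanK ha0 ha1 hu hA⟩
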